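/- We work either in the smooth category ($\mathbb{K}=\mathbb{R}$) or in the complex-analytic category ($\mathbb{K}=\mathbb{C}$, with holomorphic tangent bundles and holomorphic data). Let $E$ be a vector bundle over a manifold $M$, with typical fibre $F$ (of finite dimension) and structural group a Lie subgroup $G$ of $\mathrm{GL}(F)$; let $P$ be the corresponding frame bundle of $E$. Let $\nabla$ be a connection on $E$ compatible with $G$ (that is, its local connection forms, with respect to local sections of $P$, take values in the Lie algebra $\mathfrak{g}$ of $G$), and let $R$ be its curvature form. Let $\rho:E\to TM$ be a morphism of vector bundles, and let $T$ be the torsion of $\nabla$ with respect to $\rho$, that is, the section of $TM\otimes\Lambda^2E^*$ characterised by $$T(s_1,s_2)=\rho\bigl(\nabla_{\rho s_1}s_2-\nabla_{\rho s_2}s_1\bigr)-[\rho s_1,\rho s_2]$$ for any local sections $s_1,s_2$ of $E$. Let $S$ be a submanifold of a Grassmannian of $F$ on which $G$ acts transitively, let $Z=P\times_GS$ be the associated subbundle of a Grassmannian bundle of $E$, with projection $\pi:Z\to M$, and let $\mathcal{H}\subseteq TZ$ be the connection on $Z$ induced by $\nabla$. A point $p\in Z$ is thus a vector subspace of $E_{\pi(p)}$.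 Suppose that, for any $p\in Z$, the restriction of $\rho$ to $p$ is injective, and let $\mathcal{C}$ be the distribution on $Z$ characterised by $\mathcal{C}\subseteq\mathcal{H}$ and $\mathrm{d}\pi(\mathcal{C}_p)=\rho(p)$ for any $p\in Z$. Then the following assertions are equivalent: (i) $\mathcal{C}$ is integrable (that is, the Lie bracket of any two local sections of $\mathcal{C}$ is a local section of $\mathcal{C}$); (ii) $R\bigl(\Lambda^2(\rho(p))\bigr)(p)\subseteq p$ and $T(\Lambda^2p)\subseteq\rho(p)$, for any $p\in Z$. Consequently, if $T=0$ and $\mathcal{C}$ is integrable then $$R\bigl(\rho(e_1),\rho(e_2)\bigr)e_3+R\bigl(\rho(e_2),\rho(e_3)\bigr)e_1+R\bigl(\rho(e_3),\rho(e_1)\bigr)e_2=0,$$ for any $p\in Z$ and any $e_1,e_2,e_3\in p$. -/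

import Mathlib

open scoped Manifold ContDiff Topology

noncomputable section

/-! ### Structure groups -/

section StructureGroup

variable {𝕜 : Type*} [RCLike 𝕜]
  {EG : Type*} [NormedAddCommGroup EG] [NormedSpace 𝕜 EG]
  {HG : Type*} [TopologicalSpace HG] (IG : ModelWithCorners 𝕜 EG HG)
  {G : Type*} [TopologicalSpace G] [ChartedSpace HG G] [Group G]
  {F : Type*} [NormedAddCommGroup F] [NormedSpace 𝕜 F]

/-- `φ` exhibits the Lie group `G` as a Lie subgroup of the general linear group of `F`: it is an
injective immersive homomorphism. -/
structure IsLinearLieGroup (φ : G →* (F ≃L[𝕜] F)) : Prop where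
  contMDiff : ContMDiff IG 𝓘(𝕜, F →L[𝕜] F) ∞ (fun g : G ↦ (φ g : F →L[𝕜] F))
  injective : Function.Injective φ
  injective_mfderiv : Function.Injective
    (mfderiv IG 𝓘(𝕜, F →L[𝕜] F) (fun g : G ↦ (φ g : F →L[𝕜] F)) 1)

/-- The infinitesimal representation of the Lie algebra `𝔤 = T₁G` on `F`. -/
def lieAlgebraRep (φ : G →* (F ≃L[𝕜] F)) : GroupLieAlgebra IG G →L[𝕜] (F →L[𝕜] F) :=
  mfderiv IG 𝓘(𝕜, F →L[𝕜] F) (fun g : G ↦ (φ g : F →L[𝕜] F)) 1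

variable {ES : Type*} [NormedAddCommGroup ES] [NormedSpace 𝕜 ES]
  {HS : Type*} [TopologicalSpace HS] (IS : ModelWithCorners 𝕜 ES HS)
  {S : Type*} [TopologicalSpace S] [ChartedSpace HS S]

/-- The value at `s` of the fundamental vector field on `S` induced by `A ∈ 𝔤`, that is, the
derivative at `t = 0` of `exp (t A) • s`. -/
def infinitesimalAction [MulAction G S] (s : S) : GroupLieAlgebra IG G →L[𝕜] TangentSpace IS s :=
  mfderiv IG IS (fun g : G ↦ g • s) 1

/-- The subspace of `F` which is the graph of a linear map `a` from `p` to `q`. For `q` a complement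
of `p`, the map `a ↦ graphSubspace a` is (the inverse of) the standard chart of the Grassmannian
of `F` around `p`. -/
def graphSubspace {p q : Submodule 𝕜 F} (a : p →L[𝕜] q) : Submodule 𝕜 F :=
  LinearMap.range (p.subtype + q.subtype ∘ₗ (a : p →ₗ[𝕜] q))

/-- `incl` exhibits the manifold `S` as a submanifold of the Grassmannian of `F`: it is injective
and, in the standard charts of the Grassmannian, it is a smooth immersion. -/
structure IsGrassmannianSubmanifold (incl : S → Submodule 𝕜 F) : Prop where
  injective : Function.Injective incl
  immersion : ∀ s₀ : S, ∃ q : Submodule 𝕜 F, IsCompl (incl s₀) q ∧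
    ∃ a : S → (incl s₀ →L[𝕜] q),
      ContMDiffAt IS 𝓘(𝕜, incl s₀ →L[𝕜] q) ∞ a s₀ ∧
      Function.Injective (mfderiv IS 𝓘(𝕜, incl s₀ →L[𝕜] q) a s₀) ∧
      ∀ᶠ s in 𝓝 s₀, incl s = graphSubspace (a s)

end StructureGroup

/-! ### Vector bundles with structure group `G`, and connections on them -/

section Bundle

variable {𝕜 : Type*} [RCLike 𝕜]
  {EM : Type*} [NormedAddCommGroup EM] [NormedSpace 𝕜 EM]
  {HM : Type*} [TopologicalSpace HM] (IM : ModelWithCorners 𝕜 EM HM)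
  {M : Type*} [TopologicalSpace M] [ChartedSpace HM M]
  {F : Type*} [NormedAddCommGroup F] [NormedSpace 𝕜 F]
  {E : M → Type*} [TopologicalSpace (Bundle.TotalSpace F E)]
  [∀ x, AddCommGroup (E x)] [∀ x, Module 𝕜 (E x)] [∀ x, TopologicalSpace (E x)]
  [∀ x, IsTopologicalAddGroup (E x)] [∀ x, ContinuousSMul 𝕜 (E x)]
  [FiberBundle F E]

/-- A connection is smooth if, on every open set, it maps smooth sections to smooth one-forms.
(The condition is imposed on local sections because, in the complex-analytic category, there may
be few global ones.) -/
def IsSmoothConnection [IsManifold IM 1 M] [VectorBundle 𝕜 F E]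
    (cov : CovariantDerivative IM F E) : Prop :=
  ∀ U : Set M, IsOpen U → ContMDiffCovariantDerivativeOn F ∞ cov.toFun U

/-- The torsion, with respect to `ρ : E → TM`, of a connection on `E`: the tensor field given by
`T(s₁, s₂) = ρ (∇_{ρ s₁} s₂ - ∇_{ρ s₂} s₁) - [ρ s₁, ρ s₂]` for local sections `s₁`, `s₂` of `E`.
Its value on `e₁, e₂ ∈ E x` is computed on smooth local sections extending `e₁`, `e₂`. -/
def anchoredTorsion (cov : CovariantDerivative IM F E) (ρ : ∀ x, E x →L[𝕜] TangentSpace IM x)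
    (x : M) (e₁ e₂ : E x) : TangentSpace IM x :=
  ρ x (cov (FiberBundle.extend F e₂) x (ρ x e₁) - cov (FiberBundle.extend F e₁) x (ρ x e₂))
    - VectorField.mlieBracket IM (fun y ↦ ρ y (FiberBundle.extend F e₁ y))
        (fun y ↦ ρ y (FiberBundle.extend F e₂ y)) x

/-- The curvature of a connection on `E`: the tensor field given by
`R(X, Y) s = ∇_X ∇_Y s - ∇_Y ∇_X s - ∇_{[X, Y]} s`. Its value on `v, w ∈ T_x M` and `e ∈ E x` is
computed on smooth local sections extending `v`, `w`, `e`. -/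
def connectionCurvature [IsManifold IM 1 M] (cov : CovariantDerivative IM F E)
    (x : M) (v w : TangentSpace IM x) (e : E x) : E x :=
  cov (fun y ↦ cov (FiberBundle.extend F e) y
      (FiberBundle.extend (E := (TangentSpace IM : M → Type _)) EM w y)) x v
    - cov (fun y ↦ cov (FiberBundle.extend F e) y
        (FiberBundle.extend (E := (TangentSpace IM : M → Type _)) EM v y)) x w
    - cov (FiberBundle.extend F e) x
        (VectorField.mlieBracket IM
          (FiberBundle.extend (E := (TangentSpace IM : M → Type _)) EM v)
          (FiberBundle.extend (E := (TangentSpace IM : M → Type _)) EM w) x)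

variable {EG : Type*} [NormedAddCommGroup EG] [NormedSpace 𝕜 EG]
  {HG : Type*} [TopologicalSpace HG] (IG : ModelWithCorners 𝕜 EG HG)
  {G : Type*} [TopologicalSpace G] [ChartedSpace HG G] [Group G]

/-- A reduction of the structure group of the vector bundle `E`, with typical fibre `F`, to `G`:
a covering of the base by open sets over which there are smooth frames (that is, smooth local
sections `x ↦ frame i x : F ≃ E x` of the frame bundle), any two of which differ by a smooth
function with values in `G`. (The values of `frame i` and of `transition i j` outside `baseSet i`,
respectively `baseSet i ∩ baseSet j`, are irrelevant.) -/
structure GStructure (E : M → Type*) [TopologicalSpace (Bundle.TotalSpace F E)]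
    [∀ x, AddCommGroup (E x)] [∀ x, Module 𝕜 (E x)] [∀ x, TopologicalSpace (E x)]
    [FiberBundle F E] (φ : G →* (F ≃L[𝕜] F)) (ι : Type*) where
  baseSet : ι → Set M
  isOpen_baseSet : ∀ i, IsOpen (baseSet i)
  indexAt : M → ι
  mem_baseSet_at : ∀ x, x ∈ baseSet (indexAt x)
  frame : ι → ∀ x, F ≃L[𝕜] E x
  contMDiffOn_frame : ∀ i (ξ : F), ContMDiffOn IM (IM.prod 𝓘(𝕜, F)) ∞
    (fun x ↦ Bundle.TotalSpace.mk' F x (frame i x ξ)) (baseSet i)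
  transition : ι → ι → M → G
  contMDiffOn_transition : ∀ i j,
    ContMDiffOn IM IG ∞ (transition i j) (baseSet i ∩ baseSet j)
  frame_transition : ∀ i j, ∀ x ∈ baseSet i ∩ baseSet j, ∀ ξ : F,
    frame j x (φ (transition i j x) ξ) = frame i x ξ

namespace GStructure

variable {IM IG} {φ : G →* (F ≃L[𝕜] F)} {ι : Type*} (P : GStructure IM IG E φ ι)

/-- The local connection form `Γ` of a connection with respect to the frame `u = frame i`: it is
characterised by `∇_v (u ξ) = u (Γ(v) ξ)`, for `ξ ∈ F`. -/
def connectionForm (cov : CovariantDerivative IM F E) (i : ι) (x : M) (v : TangentSpace IM x)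
    (ξ : F) : F :=
  (P.frame i x).symm (cov (fun y ↦ P.frame i y ξ) x v)

/-- The connection is compatible with the structure group `G`: its local connection forms take
values in the Lie algebra of `G`. -/
def IsCompatible (cov : CovariantDerivative IM F E) : Prop :=
  ∀ i, ∀ x ∈ P.baseSet i, ∀ v : TangentSpace IM x, ∃ A : GroupLieAlgebra IG G,
    ∀ ξ : F, lieAlgebraRep IG φ A ξ = P.connectionForm cov i x v ξ

end GStructure

end Bundle

/-! ### The associated bundle `Z = P ×_G S` -/

section OrbitBundle

variable {𝕜 : Type*} [RCLike 𝕜]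
  {EM : Type*} [NormedAddCommGroup EM] [NormedSpace 𝕜 EM]
  {HM : Type*} [TopologicalSpace HM] {IM : ModelWithCorners 𝕜 EM HM}
  {M : Type*} [TopologicalSpace M] [ChartedSpace HM M]
  {F : Type*} [NormedAddCommGroup F] [NormedSpace 𝕜 F]
  {E : M → Type*} [TopologicalSpace (Bundle.TotalSpace F E)]
  [∀ x, AddCommGroup (E x)] [∀ x, Module 𝕜 (E x)] [∀ x, TopologicalSpace (E x)]
  [FiberBundle F E]
  {EG : Type*} [NormedAddCommGroup EG] [NormedSpace 𝕜 EG]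
  {HG : Type*} [TopologicalSpace HG] {IG : ModelWithCorners 𝕜 EG HG}
  {G : Type*} [TopologicalSpace G] [ChartedSpace HG G] [Group G]
  {φ : G →* (F ≃L[𝕜] F)} {ι : Type*}

lemma GStructure.transition_self (P : GStructure IM IG E φ ι) (hφ : Function.Injective φ) {i : ι} {x : M} (hx : x ∈ P.baseSet i) :
    P.transition i i x = 1 := by
  apply hφ
  ext ξ
  apply (P.frame i x).injective
  rw [map_one]
  exact P.frame_transition i i x ⟨hx, hx⟩ ξ

lemma GStructure.transition_mul (P : GStructure IM IG E φ ι) (hφ : Function.Injective φ) {i j k : ι} {x : M} (hi : x ∈ P.baseSet i)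
    (hj : x ∈ P.baseSet j) (hk : x ∈ P.baseSet k) :
    P.transition j k x * P.transition i j x = P.transition i k x := by
  apply hφ
  ext ξ
  apply (P.frame k x).injective
  rw [P.frame_transition i k x ⟨hi, hk⟩, map_mul]
  exact (P.frame_transition j k x ⟨hj, hk⟩ _).trans (P.frame_transition i j x ⟨hi, hj⟩ ξ)

variable {ES : Type*} [NormedAddCommGroup ES] [NormedSpace 𝕜 ES]
  {HS : Type*} [TopologicalSpace HS] (IS : ModelWithCorners 𝕜 ES HS)
  (S : Type*) [TopologicalSpace S] [ChartedSpace HS S] [MulAction G S]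
  [ContMDiffSMul IG IS ∞ G S]

/-- The cocycle data of the bundle with fibre `S` associated to a `G`-structure: in the
trivialization given by a frame `u`, the pair `(x, s)` corresponds to the class of `(u x, s)`
in `P ×_G S`. -/
def GStructure.fiberBundleCore (P : GStructure IM IG E φ ι) (hφ : IsLinearLieGroup IG φ) :
    FiberBundleCore ι M S where
  baseSet := P.baseSet
  isOpen_baseSet := P.isOpen_baseSet
  indexAt := P.indexAt
  mem_baseSet_at := P.mem_baseSet_at
  coordChange i j x s := P.transition i j x • s
  coordChange_self i x hx s := by rw [P.transition_self hφ.injective hx, one_smul]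
  continuousOn_coordChange i j := by
    have : ContinuousSMul G S := ContMDiffSMul.continuousSMul (I := IG) (I' := IS) ∞
    exact ((P.contMDiffOn_transition i j).continuousOn.comp continuousOn_fst
      (fun p hp ↦ hp.1)).smul continuousOn_snd
  coordChange_comp i j k x hx s := by
    rw [smul_smul, P.transition_mul hφ.injective hx.1.1 hx.1.2 hx.2]

/-- The total space of the bundle `Z = P ×_G S`. -/
def OrbitBundle (P : GStructure IM IG E φ ι) (hφ : IsLinearLieGroup IG φ) : Type _ :=
  (P.fiberBundleCore IS S hφ).TotalSpace

namespace OrbitBundle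

variable {IS S} {P : GStructure IM IG E φ ι} {hφ : IsLinearLieGroup IG φ}

instance : TopologicalSpace (OrbitBundle IS S P hφ) :=
  inferInstanceAs (TopologicalSpace (P.fiberBundleCore IS S hφ).TotalSpace)

/-- The charts of `Z` are the local trivializations followed by products of charts of the base and
of the fibre. -/
instance : ChartedSpace (ModelProd HM HS) (OrbitBundle IS S P hφ) :=
  @ChartedSpace.comp (ModelProd HM HS) _ (M × S) _ (OrbitBundle IS S P hφ) _ _
    (inferInstanceAs (ChartedSpace (M × S) (P.fiberBundleCore IS S hφ).TotalSpace))

/-- The projection of `Z` onto `M`. -/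
def proj (z : OrbitBundle IS S P hφ) : M :=
  Bundle.TotalSpace.proj (F := S) (E := (P.fiberBundleCore IS S hφ).Fiber) z

/-- The component in `S` of a point of `Z`, with respect to the trivialization of `Z` given by
`frame i`. -/
def coord (i : ι) (z : OrbitBundle IS S P hφ) : S :=
  ((P.fiberBundleCore IS S hφ).localTriv i z).2

/-- The transition functions between charts of `Z` are smooth. -/
instance [IsManifold IM ∞ M] [IsManifold IS ∞ S] :
    IsManifold (IM.prod IS) ∞ (OrbitBundle IS S P hφ) := by
  apply isManifold_of_contDiffOn
  rintro _ _ ⟨_, ⟨_, ⟨i, rfl⟩, rfl⟩, c, hc, rfl⟩ ⟨_, ⟨_, ⟨j, rfl⟩, rfl⟩, c', hc', rfl⟩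
  set e := ((P.fiberBundleCore IS S hφ).localTriv i).toOpenPartialHomeomorph
  set e' := ((P.fiberBundleCore IS S hφ).localTriv j).toOpenPartialHomeomorph
  have h1 : ContMDiffOn (IM.prod IS) (IM.prod IS) ∞ c.symm c.target :=
    contMDiffOn_symm_of_mem_maximalAtlas (IsManifold.subset_maximalAtlas hc)
  have h3 : ContMDiffOn (IM.prod IS) (IM.prod IS) ∞ c' c'.source :=
    contMDiffOn_of_mem_maximalAtlas (IsManifold.subset_maximalAtlas hc')
  have hsource : ∀ p ∈ (e.symm ≫ₕ e').source, p.1 ∈ P.baseSet i ∩ P.baseSet j := by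
    intro p hp
    have hp' : p.1 ∈ ((P.fiberBundleCore IS S hφ).localTriv i).baseSet ∧
        p.1 ∈ ((P.fiberBundleCore IS S hφ).localTriv j).baseSet := by simpa [e, e'] using hp
    exact hp'
  have h2 : ContMDiffOn (IM.prod IS) (IM.prod IS) ∞ (e.symm ≫ₕ e') (e.symm ≫ₕ e').source := by
    have h4 : ContMDiffOn (IM.prod IS) (IM.prod IS) ∞
        (fun p : M × S ↦ (p.1, P.transition i j p.1 • p.2)) (e.symm ≫ₕ e').source := by
      refine contMDiffOn_fst.prodMk ?_
      have h5 : ContMDiffOn (IM.prod IS) (IG.prod IS) ∞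
          (fun p : M × S ↦ (P.transition i j p.1, p.2)) (e.symm ≫ₕ e').source :=
        ((P.contMDiffOn_transition i j).comp contMDiffOn_fst hsource).prodMk contMDiffOn_snd
      exact (contMDiff_smul (I := IG) (I' := IS) (n := ∞) (G := G) (M := S)).comp_contMDiffOn h5
    refine h4.congr fun p hp ↦ ?_
    have hp' := hsource p hp
    have h6 : (e.symm ≫ₕ e') p = (p.1, (P.fiberBundleCore IS S hφ).coordChange
        (P.indexAt p.1) j p.1 ((P.fiberBundleCore IS S hφ).coordChange i (P.indexAt p.1) p.1 p.2)) :=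
      rfl
    rw [h6, (P.fiberBundleCore IS S hφ).coordChange_comp i (P.indexAt p.1) j p.1
      ⟨⟨hp'.1, P.mem_baseSet_at p.1⟩, hp'.2⟩]
    rfl
  have key : ContMDiffOn (IM.prod IS) (IM.prod IS) ∞ (c' ∘ (e.symm ≫ₕ e') ∘ c.symm)
      (c.symm ≫ₕ (e.symm ≫ₕ e') ≫ₕ c').source := by
    refine h3.comp (h2.comp (h1.mono ?_) ?_) ?_ <;> intro x hx <;>
      simp only [mfld_simps] at hx ⊢ <;> tauto
  rw [← contMDiffOn_iff_contDiffOn]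
  refine (IM.prod IS).contMDiff.comp_contMDiffOn
    (key.comp ((IM.prod IS).contMDiffOn_symm.mono Set.inter_subset_right) ?_)
  intro x hx
  have hx' : (IM.prod IS).symm x ∈ ((e ≫ₕ c).symm ≫ₕ (e' ≫ₕ c')).source := hx.1
  simp only [mfld_simps] at hx' ⊢
  tauto

/-- The subspace of the fibre of `E` which a point of `Z` is: in the frame `u` at `x`, the class of
`(u, s)` is the subspace `u s` of `E x`. -/
def subspace (incl : S → Submodule 𝕜 F) (z : OrbitBundle IS S P hφ) : Submodule 𝕜 (E z.proj) :=
  (incl (z.coord (P.indexAt z.proj))).map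
    ((P.frame (P.indexAt z.proj) z.proj : F →L[𝕜] E z.proj) : F →ₗ[𝕜] E z.proj)

/-- The subspace of the fibre of `E` associated to a point of `Z` can be computed in any frame. -/
lemma subspace_eq {incl : S → Submodule 𝕜 F}
    (hsmul : ∀ (g : G) (s : S),
      incl (g • s) = (incl s).map ((φ g : F →L[𝕜] F) : F →ₗ[𝕜] F))
    (z : OrbitBundle IS S P hφ) {i : ι} (hi : z.proj ∈ P.baseSet i) :
    z.subspace incl = (incl (z.coord i)).map
      ((P.frame i z.proj : F →L[𝕜] E z.proj) : F →ₗ[𝕜] E z.proj) := by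
  have h : ∀ j, z.coord j = P.transition (P.indexAt z.proj) j z.proj • (show S from z.2) :=
    fun _ ↦ rfl
  have hx := P.mem_baseSet_at z.proj
  rw [subspace, h, h, P.transition_self hφ.injective hx, one_smul, hsmul, ← Submodule.map_comp]
  congr 1
  ext ξ
  exact (P.frame_transition _ i z.proj ⟨hx, hi⟩ ξ).symm

variable [∀ x, IsTopologicalAddGroup (E x)] [∀ x, ContinuousSMul 𝕜 (E x)]

/-- The connection `ℋ ⊆ TZ` induced on `Z` by a connection on `E` compatible with `G`: in the
trivialization of `Z` given by a frame with local connection form `Γ`, it is formed of the vectors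
`(v, -(Γ(v) s))` tangent at `(x, s)`, where `Γ(v) ∈ 𝔤` acts on `S` by the fundamental vector
field. -/
def horizontal (cov : CovariantDerivative IM F E) (z : OrbitBundle IS S P hφ) :
    Submodule 𝕜 (TangentSpace (IM.prod IS) z) where
  carrier := {w | ∀ i, z.proj ∈ P.baseSet i → ∃ A : GroupLieAlgebra IG G,
    (∀ ξ : F, lieAlgebraRep IG φ A ξ =
      P.connectionForm cov i z.proj (mfderiv (IM.prod IS) IM proj z w) ξ) ∧
    mfderiv (IM.prod IS) IS (coord i) z w = -infinitesimalAction IG IS (z.coord i) A}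
  zero_mem' i _ := ⟨0, by simp [GStructure.connectionForm], by simp⟩
  add_mem' {w w'} hw hw' i hi := by
    obtain ⟨A, h1, h2⟩ := hw i hi
    obtain ⟨A', h1', h2'⟩ := hw' i hi
    refine ⟨A + A', fun ξ ↦ ?_, ?_⟩
    · simp only [map_add, add_apply, h1, h1', GStructure.connectionForm]
    · simp only [map_add, h2, h2', neg_add]
  smul_mem' c w hw i hi := by
    obtain ⟨A, h1, h2⟩ := hw i hi
    refine ⟨c • A, fun ξ ↦ ?_, ?_⟩
    · simp only [map_smul, smul_apply, h1, GStructure.connectionForm]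
    · simp only [map_smul, h2, smul_neg]

/-- The distribution `𝒞` on `Z`: it is formed of the horizontal vectors at `p ∈ Z` which project
into `ρ(p)`. -/
def distribution (cov : CovariantDerivative IM F E) (ρ : ∀ x, E x →L[𝕜] TangentSpace IM x)
    (incl : S → Submodule 𝕜 F) (z : OrbitBundle IS S P hφ) :
    Submodule 𝕜 (TangentSpace (IM.prod IS) z) :=
  z.horizontal cov ⊓
    ((z.subspace incl).map (ρ z.proj : E z.proj →ₗ[𝕜] TangentSpace IM z.proj)).comap
      (mfderiv (IM.prod IS) IM proj z :
        TangentSpace (IM.prod IS) z →ₗ[𝕜] TangentSpace IM z.proj)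

end OrbitBundle

end OrbitBundle

/-! ### Integrable distributions -/

/-- A distribution `D` on a manifold is integrable if the Lie bracket of any two local sections
of `D` is a local section of `D`. -/
def IsIntegrableDistribution {𝕜 : Type*} [RCLike 𝕜]
    {EN : Type*} [NormedAddCommGroup EN] [NormedSpace 𝕜 EN]
    {HN : Type*} [TopologicalSpace HN] (J : ModelWithCorners 𝕜 EN HN)
    {N : Type*} [TopologicalSpace N] [ChartedSpace HN N] [IsManifold J 1 N]
    (D : ∀ z : N, Submodule 𝕜 (TangentSpace J z)) : Prop :=
  ∀ U : Set N, IsOpen U → ∀ X Y : ∀ z : N, TangentSpace J z,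
    ContMDiffOn J J.tangent ∞ (fun z ↦ (⟨z, X z⟩ : TangentBundle J N)) U →
    ContMDiffOn J J.tangent ∞ (fun z ↦ (⟨z, Y z⟩ : TangentBundle J N)) U →
    (∀ z ∈ U, X z ∈ D z) → (∀ z ∈ U, Y z ∈ D z) →
    ∀ z ∈ U, VectorField.mlieBracket J X Y z ∈ D z

end

/-!
Pull `∇` back along the projection `Z → M`. A tangent vector of `Z` is horizontal exactly when the
pulled-back derivative along it sends tautological sections, those with value in the subspace `p`
at each point `p` of `Z`, into `p`. For horizontal fields `X` and `Y`, the commutator of the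
pulled-back derivatives along `X` and `Y` therefore preserves the tautological sections; it differs
from the derivative along `[X, Y]` by `R(dπ X, dπ Y)`, so `[X, Y]` is horizontal if and only if
`R(dπ X, dπ Y)` preserves `p`.

As `ρ` is injective on each `p`, sections `X` and `Y` of `𝒞` lift to tautological sections `s₁` and
`s₂`, and the defining formula of the torsion becomes
`dπ [X, Y] = ρ (∇_X s₂ - ∇_Y s₁) - T(s₁, s₂)`, whose first term lies in `ρ(p)`.

If `T = 0`, then Bianchi's identity says that `ρ` annihilates the cyclic sum of `R(ρ e₁, ρ e₂) e₃`.
When `𝒞` is integrable this sum lies in `p`, where `ρ` is injective.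
-/

noncomputable section

section VectorFields

open VectorField

variable {𝕜 : Type*} [RCLike 𝕜]
  {EN : Type*} [NormedAddCommGroup EN] [NormedSpace 𝕜 EN]
  {HN : Type*} [TopologicalSpace HN] {J : ModelWithCorners 𝕜 EN HN}
  {N : Type*} [TopologicalSpace N] [ChartedSpace HN N]
  {V : Type*} [NormedAddCommGroup V] [NormedSpace 𝕜 V]
  {V' : Type*} [NormedAddCommGroup V'] [NormedSpace 𝕜 V']
  {h : N → V} {z : N} {X Y : ∀ z : N, TangentSpace J z}

lemma mvfderiv_congr {h' : N → V} (H : h =ᶠ[𝓝 z] h') : mvfderiv J h z = mvfderiv J h' z := by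
  ext W
  exact congrArg (fun L : EN →L[𝕜] V ↦ L W) (H.mfderiv_eq (I := J) (I' := 𝓘(𝕜, V)))

lemma mvfderiv_fun_comp_apply {EM : Type*} [NormedAddCommGroup EM] [NormedSpace 𝕜 EM]
    {HM : Type*} [TopologicalSpace HM] {I : ModelWithCorners 𝕜 EM HM}
    {M : Type*} [TopologicalSpace M] [ChartedSpace HM M] {g : M → V} {f : N → M}
    (hg : MDifferentiableAt I 𝓘(𝕜, V) g (f z)) (hf : MDifferentiableAt J I f z)
    (W : TangentSpace J z) :
    mvfderiv J (fun y ↦ g (f y)) z W = mvfderiv I g (f z) (mfderiv J I f z W) :=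
  congrArg (fun L : EN →L[𝕜] V ↦ L W) (mfderiv_comp z hg hf)

lemma mvfderiv_eq_fderiv {f : EN → V} {ζ : EN} : mvfderiv 𝓘(𝕜, EN) f ζ = fderiv 𝕜 f ζ := by
  ext W
  exact congrArg (fun L : EN →L[𝕜] V ↦ L W) mfderiv_eq_fderiv

lemma mvfderiv_clm_apply {A : N → V →L[𝕜] V'} {b : N → V}
    (hA : MDifferentiableAt J 𝓘(𝕜, V →L[𝕜] V') A z) (hb : MDifferentiableAt J 𝓘(𝕜, V) b z)
    (W : TangentSpace J z) :
    mvfderiv J (fun y ↦ A y (b y)) z W = mvfderiv J A z W (b z) + A z (mvfderiv J b z W) := by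
  have hu : UniqueDiffWithinAt 𝕜 (Set.range J) (extChartAt J z z) :=
    J.uniqueDiffOn _ (Set.mem_range_self _)
  have h := (hA.hasMFDerivAt.2.clm_apply hb.hasMFDerivAt.2).fderivWithin hu
  have hz : (extChartAt J z).symm (extChartAt J z z) = z := extChartAt_to_inv z
  rw [(hA.clm_apply hb).mvfderiv]
  refine (congrArg (fun L : EN →L[𝕜] V' ↦ L W) h).trans ?_
  simp only [writtenInExtChartAt, extChartAt_model_space_eq_id, PartialEquiv.refl_coe,
    Function.comp_apply, hz, id]
  exact add_comm _ _

lemma mdifferentiableAt_mvfderiv_apply [IsManifold J 1 N] (hh : ContMDiffAt J 𝓘(𝕜, V) 2 h z)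
    (hY : MDiffAt (T% Y) z) :
    MDifferentiableAt J 𝓘(𝕜, V) (fun y ↦ mvfderiv J h y (Y y)) z := by
  have hdh := hh.mfderiv_const (m := 1) (by norm_num [one_add_one_eq_two])
  have hdhY := (hdh.mdifferentiableAt one_ne_zero).clm_apply_of_inCoordinates hY
    (hh.mdifferentiableAt two_ne_zero)
  exact (contMDiff_snd_tangentBundle_modelSpace V 𝓘(𝕜, V) (n := 1)).contMDiffAt.mdifferentiableAt
    one_ne_zero |>.comp _ hdhY

/-- The vector field `X` read in the preferred chart at `z`. -/
def vectorFieldInChart (J : ModelWithCorners 𝕜 EN HN) (z : N) (X : ∀ z : N, TangentSpace J z) :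
    EN → EN :=
  mpullbackWithin 𝓘(𝕜, EN) J (extChartAt J z).symm X (Set.range J)

lemma differentiableAt_vectorFieldInChart [J.Boundaryless] [IsManifold J 2 N] [CompleteSpace EN]
    (hX : MDiffAt (T% X) z) :
    DifferentiableAt 𝕜 (vectorFieldInChart J z X) (extChartAt J z z) := by
  rw [← mdifferentiableWithinAt_univ] at hX
  have hX' := hX.differentiableWithinAt_mpullbackWithin_vectorField
  rw [Set.preimage_univ, Set.univ_inter, J.range_eq_univ] at hX'
  simp only [vectorFieldInChart, J.range_eq_univ]
  exact differentiableWithinAt_univ.1 hX'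

lemma vectorFieldInChart_self [IsManifold J 1 N] :
    vectorFieldInChart J z X (extChartAt J z z) = X z := by
  have hval : ∀ y, y = z → (X y : EN) = X z := by rintro _ rfl; rfl
  simp only [vectorFieldInChart, mpullbackWithin_apply]
  rw [mfderivWithin_range_extChartAt_symm]
  exact (congrArg (fun L : EN →L[𝕜] EN ↦ L _) ContinuousLinearMap.inverse_id).trans
    (hval _ (extChartAt_to_inv z))

lemma fderiv_comp_extChartAt_symm_vectorFieldInChart [J.Boundaryless] [IsManifold J 1 N] {ζ : EN}
    (hζ : ζ ∈ (extChartAt J z).target)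
    (hh : MDifferentiableAt J 𝓘(𝕜, V) h ((extChartAt J z).symm ζ)) :
    fderiv 𝕜 (h ∘ (extChartAt J z).symm) ζ (vectorFieldInChart J z X ζ)
      = mvfderiv J h ((extChartAt J z).symm ζ) (X ((extChartAt J z).symm ζ)) := by
  have hsymm : MDifferentiableAt 𝓘(𝕜, EN) J (extChartAt J z).symm ζ := by
    simpa only [J.range_eq_univ, mdifferentiableWithinAt_univ] using
      mdifferentiableWithinAt_extChartAt_symm (I := J) (x := z) hζ
  have hX : mfderiv 𝓘(𝕜, EN) J (extChartAt J z).symm ζ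
      (mpullbackWithin 𝓘(𝕜, EN) J (extChartAt J z).symm X (Set.range J) ζ)
      = X ((extChartAt J z).symm ζ) := by
    have hinv := isInvertible_mfderivWithin_extChartAt_symm (I := J) (x := z) hζ
    simp only [mpullbackWithin_apply, J.range_eq_univ, mfderivWithin_univ] at hinv ⊢
    exact hinv.self_apply_inverse _
  rw [← hX, ← mvfderiv_fun_comp_apply hh hsymm, mvfderiv_eq_fderiv]
  rfl

lemma mvfderiv_eq_fderiv_comp_extChartAt_symm [J.Boundaryless]
    (hh : MDifferentiableAt J 𝓘(𝕜, V) h z) :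
    mvfderiv J h z = fderiv 𝕜 (h ∘ (extChartAt J z).symm) (extChartAt J z z) := by
  rw [hh.mvfderiv, J.range_eq_univ, fderivWithin_univ]
  rfl

lemma mlieBracket_eq_lieBracket_vectorFieldInChart [J.Boundaryless] [IsManifold J 1 N] :
    mlieBracket J X Y z
      = lieBracket 𝕜 (vectorFieldInChart J z X) (vectorFieldInChart J z Y) (extChartAt J z z) := by
  rw [← mlieBracketWithin_univ, mlieBracketWithin_apply, mfderiv_extChartAt_self]
  refine (congrArg (fun L : EN →L[𝕜] EN ↦ L _) ContinuousLinearMap.inverse_id).trans ?_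
  simp only [Set.preimage_univ, Set.univ_inter, J.range_eq_univ, vectorFieldInChart]
  exact congrFun lieBracketWithin_univ _

lemma eventually_mvfderiv_apply_comp_extChartAt_symm [J.Boundaryless] [IsManifold J 1 N]
    (hh : ContMDiffAt J 𝓘(𝕜, V) 1 h z) :
    (fun y ↦ mvfderiv J h y (X y)) ∘ (extChartAt J z).symm =ᶠ[𝓝 (extChartAt J z z)]
      fun ζ ↦ fderiv 𝕜 (h ∘ (extChartAt J z).symm) ζ (vectorFieldInChart J z X ζ) := by
  have hdiff : ∀ᶠ y in 𝓝 ((extChartAt J z).symm (extChartAt J z z)),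
      MDifferentiableAt J 𝓘(𝕜, V) h y := by
    rw [extChartAt_to_inv]
    exact ((contMDiffAt_iff_contMDiffAt_nhds (by simp)).1 hh).mono
      fun y hy ↦ hy.mdifferentiableAt one_ne_zero
  filter_upwards [(continuousAt_extChartAt_symm z).eventually hdiff,
    extChartAt_target_mem_nhds (I := J) z] with ζ hdiffζ hζ
  exact (fderiv_comp_extChartAt_symm_vectorFieldInChart hζ hdiffζ).symm

theorem mvfderiv_mlieBracket [J.Boundaryless] [IsManifold J 2 N] [CompleteSpace EN]
    (hh : ContMDiffAt J 𝓘(𝕜, V) 2 h z) (hX : MDiffAt (T% X) z) (hY : MDiffAt (T% Y) z) :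
    mvfderiv J h z (mlieBracket J X Y z)
      = mvfderiv J (fun y ↦ mvfderiv J h y (Y y)) z (X z)
        - mvfderiv J (fun y ↦ mvfderiv J h y (X y)) z (Y z) := by
  have : IsManifold J 1 N := .of_le one_le_two
  have hsymm : ContMDiffAt 𝓘(𝕜, EN) J 2 (extChartAt J z).symm (extChartAt J z z) := by
    simpa only [J.range_eq_univ, contMDiffWithinAt_univ] using
      contMDiffWithinAt_extChartAt_symm_range_self (I := J) (n := 2) z
  have hchart : ContDiffAt 𝕜 2 (h ∘ (extChartAt J z).symm) (extChartAt J z z) :=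
    contMDiffAt_iff_contDiffAt.1 <|
      ContMDiffAt.comp (extChartAt J z z) (by rwa [extChartAt_to_inv]) hsymm
  have hiter {W W' : ∀ z : N, TangentSpace J z} (hW : MDiffAt (T% W) z) :
      mvfderiv J (fun y ↦ mvfderiv J h y (W y)) z (W' z)
        = fderiv 𝕜 (fun ζ ↦ fderiv 𝕜 (h ∘ (extChartAt J z).symm) ζ (vectorFieldInChart J z W ζ))
          (extChartAt J z z) (vectorFieldInChart J z W' (extChartAt J z z)) := by
    rw [mvfderiv_eq_fderiv_comp_extChartAt_symm (mdifferentiableAt_mvfderiv_apply hh hW),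
      (eventually_mvfderiv_apply_comp_extChartAt_symm (hh.of_le one_le_two)).fderiv_eq,
      vectorFieldInChart_self]
    rfl
  rw [hiter hX, hiter hY, mlieBracket_eq_lieBracket_vectorFieldInChart,
    mvfderiv_eq_fderiv_comp_extChartAt_symm (hh.mdifferentiableAt two_ne_zero)]
  exact fderiv_apply_lieBracket (E := EN) (x := extChartAt J z z) hchart
    (by simp) (differentiableAt_vectorFieldInChart hY) (differentiableAt_vectorFieldInChart hX)

end VectorFields

section TrivialBundle

variable {𝕜 : Type*} [RCLike 𝕜]
  {EN : Type*} [NormedAddCommGroup EN] [NormedSpace 𝕜 EN]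
  {HN : Type*} [TopologicalSpace HN] {J : ModelWithCorners 𝕜 EN HN}
  {N : Type*} [TopologicalSpace N] [ChartedSpace HN N]
  {B : Type*} [NormedAddCommGroup B] [NormedSpace 𝕜 B]
  {F : Type*} [NormedAddCommGroup F] [NormedSpace 𝕜 F]
  {q : N → B} {Γ : B → B →L[𝕜] F →L[𝕜] F} {r : B → F →L[𝕜] B} {e f g : N → F} {z : N}
  {X Y : ∀ z : N, TangentSpace J z}

/-- The derivative of `g : N → F` along `W`, for the pull-back by `q : N → B` of the connection
with connection form `Γ` on the trivial bundle with fibre `F` over `B`. -/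
def covDerivAlong (J : ModelWithCorners 𝕜 EN HN) (q : N → B) (Γ : B → B →L[𝕜] F →L[𝕜] F)
    (g : N → F) (z : N) (W : TangentSpace J z) : F :=
  mvfderiv J g z W + Γ (q z) (mvfderiv J q z W) (g z)

/-- The curvature `dΓ + Γ ∧ Γ` of the connection form `Γ`. -/
def localCurvature (Γ : B → B →L[𝕜] F →L[𝕜] F) (b v w : B) (ξ : F) : F :=
  fderiv 𝕜 Γ b v w ξ - fderiv 𝕜 Γ b w v ξ + (Γ b v (Γ b w ξ) - Γ b w (Γ b v ξ))

/-- The torsion of the connection form `Γ` with respect to the anchor `r`, evaluated on constant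
sections of the trivial bundle. -/
def localTorsion (Γ : B → B →L[𝕜] F →L[𝕜] F) (r : B → F →L[𝕜] B) (b : B) (ξ η : F) : B :=
  r b (Γ b (r b ξ) η - Γ b (r b η) ξ) - (fderiv 𝕜 r b (r b ξ) η - fderiv 𝕜 r b (r b η) ξ)

lemma mvfderiv_comp_eq_fderiv {V : Type*} [NormedAddCommGroup V] [NormedSpace 𝕜 V] {a : B → V}
    (ha : DifferentiableAt 𝕜 a (q z)) (hq : MDifferentiableAt J 𝓘(𝕜, B) q z)
    (W : TangentSpace J z) :
    mvfderiv J (fun y ↦ a (q y)) z W = fderiv 𝕜 a (q z) (mvfderiv J q z W) := by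
  rw [mvfderiv_fun_comp_apply ha.mdifferentiableAt hq, mvfderiv_eq_fderiv]
  rfl

lemma mdifferentiableAt_covDerivAlong [IsManifold J 1 N] (hq : ContMDiffAt J 𝓘(𝕜, B) 2 q z)
    (hΓ : DifferentiableAt 𝕜 Γ (q z)) (hg : ContMDiffAt J 𝓘(𝕜, F) 2 g z) (hY : MDiffAt (T% Y) z) :
    MDifferentiableAt J 𝓘(𝕜, F) (fun y ↦ covDerivAlong J q Γ g y (Y y)) z := by
  have hΓq : MDifferentiableAt J 𝓘(𝕜, B →L[𝕜] F →L[𝕜] F) (fun y ↦ Γ (q y)) z :=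
    hΓ.mdifferentiableAt.comp z (hq.mdifferentiableAt two_ne_zero)
  exact (mdifferentiableAt_mvfderiv_apply hg hY).add
    ((hΓq.clm_apply (mdifferentiableAt_mvfderiv_apply hq hY)).clm_apply
      (hg.mdifferentiableAt two_ne_zero))

lemma mvfderiv_covDerivAlong [IsManifold J 1 N] (hq : ContMDiffAt J 𝓘(𝕜, B) 2 q z)
    (hΓ : DifferentiableAt 𝕜 Γ (q z)) (hg : ContMDiffAt J 𝓘(𝕜, F) 2 g z) (hY : MDiffAt (T% Y) z)
    (W : TangentSpace J z) :
    mvfderiv J (fun y ↦ covDerivAlong J q Γ g y (Y y)) z W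
      = mvfderiv J (fun y ↦ mvfderiv J g y (Y y)) z W
        + (fderiv 𝕜 Γ (q z) (mvfderiv J q z W) (mvfderiv J q z (Y z)) (g z)
          + Γ (q z) (mvfderiv J (fun y ↦ mvfderiv J q y (Y y)) z W) (g z)
          + Γ (q z) (mvfderiv J q z (Y z)) (mvfderiv J g z W)) := by
  have hq' := hq.mdifferentiableAt two_ne_zero
  have hg' := hg.mdifferentiableAt two_ne_zero
  have hΓq : MDifferentiableAt J 𝓘(𝕜, B →L[𝕜] F →L[𝕜] F) (fun y ↦ Γ (q y)) z :=
    hΓ.mdifferentiableAt.comp z hq'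
  have hqY := mdifferentiableAt_mvfderiv_apply hq hY
  have hΓY := hΓq.clm_apply hqY
  simp only [covDerivAlong]
  rw [mvfderiv_fun_add (mdifferentiableAt_mvfderiv_apply hg hY) (hΓY.clm_apply hg'), add_apply,
    mvfderiv_clm_apply hΓY hg', mvfderiv_clm_apply hΓq hqY, mvfderiv_comp_eq_fderiv hΓ hq',
    add_apply]

variable [J.Boundaryless] [IsManifold J 2 N] [CompleteSpace EN]

theorem covDerivAlong_commutator (hq : ContMDiffAt J 𝓘(𝕜, B) 2 q z)
    (hΓ : DifferentiableAt 𝕜 Γ (q z)) (hg : ContMDiffAt J 𝓘(𝕜, F) 2 g z)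
    (hX : MDiffAt (T% X) z) (hY : MDiffAt (T% Y) z) :
    covDerivAlong J q Γ (fun y ↦ covDerivAlong J q Γ g y (Y y)) z (X z)
      - covDerivAlong J q Γ (fun y ↦ covDerivAlong J q Γ g y (X y)) z (Y z)
      - covDerivAlong J q Γ g z (VectorField.mlieBracket J X Y z)
      = localCurvature Γ (q z) (mvfderiv J q z (X z)) (mvfderiv J q z (Y z)) (g z) := by
  have : IsManifold J 1 N := .of_le one_le_two
  rw [covDerivAlong, covDerivAlong, covDerivAlong, mvfderiv_covDerivAlong hq hΓ hg hX,
    mvfderiv_covDerivAlong hq hΓ hg hY]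
  simp only [covDerivAlong, localCurvature, mvfderiv_mlieBracket hg hX hY,
    mvfderiv_mlieBracket hq hX hY, map_sub, map_add, sub_apply]
  abel

theorem mvfderiv_mlieBracket_eq_sub_localTorsion (hq : ContMDiffAt J 𝓘(𝕜, B) 2 q z)
    (hr : DifferentiableAt 𝕜 r (q z)) (he : MDifferentiableAt J 𝓘(𝕜, F) e z)
    (hf : MDifferentiableAt J 𝓘(𝕜, F) f z) (hX : MDiffAt (T% X) z) (hY : MDiffAt (T% Y) z)
    (hXe : ∀ᶠ y in 𝓝 z, mvfderiv J q y (X y) = r (q y) (e y))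
    (hYf : ∀ᶠ y in 𝓝 z, mvfderiv J q y (Y y) = r (q y) (f y)) :
    mvfderiv J q z (VectorField.mlieBracket J X Y z)
      = r (q z) (covDerivAlong J q Γ f z (X z) - covDerivAlong J q Γ e z (Y z))
        - localTorsion Γ r (q z) (e z) (f z) := by
  have hq' := hq.mdifferentiableAt two_ne_zero
  have hrq : MDifferentiableAt J 𝓘(𝕜, F →L[𝕜] B) (fun y ↦ r (q y)) z :=
    hr.mdifferentiableAt.comp z hq'
  rw [mvfderiv_mlieBracket hq hX hY, mvfderiv_congr hXe, mvfderiv_congr hYf,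
    mvfderiv_clm_apply hrq he, mvfderiv_clm_apply hrq hf, mvfderiv_comp_eq_fderiv hr hq',
    mvfderiv_comp_eq_fderiv hr hq']
  simp only [covDerivAlong, localTorsion, hXe.self_of_nhds, hYf.self_of_nhds, map_sub, map_add]
  abel

end TrivialBundle

section OperatorValuedMaps

variable {𝕜 : Type*} [RCLike 𝕜]
  {EN : Type*} [NormedAddCommGroup EN] [NormedSpace 𝕜 EN]
  {HN : Type*} [TopologicalSpace HN] {J : ModelWithCorners 𝕜 EN HN}
  {N : Type*} [TopologicalSpace N] [ChartedSpace HN N]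
  {F : Type*} [NormedAddCommGroup F] [NormedSpace 𝕜 F] [FiniteDimensional 𝕜 F]
  {V : Type*} [NormedAddCommGroup V] [NormedSpace 𝕜 V] {n : ℕ∞ω} {z : N}

lemma contMDiffAt_clm_of_apply {A : N → F →L[𝕜] V}
    (hA : ∀ ξ, ContMDiffAt J 𝓘(𝕜, V) n (fun y ↦ A y ξ) z) :
    ContMDiffAt J 𝓘(𝕜, F →L[𝕜] V) n A z := by
  let d := Module.finrank 𝕜 F
  have hd : d = Module.finrank 𝕜 (Fin d → 𝕜) := (Module.finrank_fin_fun 𝕜).symm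
  let e₁ := ContinuousLinearEquiv.ofFinrankEq hd
  let e₂ := (e₁.arrowCongr (1 : V ≃L[𝕜] V)).trans (ContinuousLinearEquiv.piRing (Fin d))
  have he₂A : ContMDiffAt J 𝓘(𝕜, Fin d → V) n (fun y ↦ e₂ (A y)) z :=
    contMDiffAt_pi_space.2 fun i ↦ hA _
  exact (e₂.symm.contDiff.contMDiff.contMDiffAt.comp z he₂A).congr_of_eventuallyEq
    (.of_forall fun y ↦ (e₂.symm_apply_apply _).symm)

lemma exists_contMDiffAt_clm {β : F → N → V} (hβ : ∀ ξ, ContMDiffAt J 𝓘(𝕜, V) n (β ξ) z)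
    (hlin : ∀ᶠ y in 𝓝 z, IsLinearMap 𝕜 fun ξ ↦ β ξ y) :
    ∃ A : N → F →L[𝕜] V, ContMDiffAt J 𝓘(𝕜, F →L[𝕜] V) n A z ∧
      ∀ᶠ y in 𝓝 z, ∀ ξ, A y ξ = β ξ y := by
  let b := Module.finBasis 𝕜 F
  let A : N → F →L[𝕜] V := fun y ↦ LinearMap.toContinuousLinearMap (b.constr 𝕜 fun k ↦ β (b k) y)
  have hA : ∀ y ξ, A y ξ = ∑ k, b.repr ξ k • β (b k) y := fun y ξ ↦ b.constr_apply_fintype 𝕜 _ ξ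
  refine ⟨A, contMDiffAt_clm_of_apply fun ξ ↦ ?_, hlin.mono fun y hy ξ ↦ ?_⟩
  · simp only [hA]
    exact contMDiffAt_finsetSum fun k _ ↦
      (contDiff_const_smul (b.repr ξ k)).contMDiff.contMDiffAt.comp z (hβ (b k))
  · exact congrArg (· ξ) (b.constr_eq 𝕜 (f := hy.mk' _) fun _ ↦ rfl)

end OperatorValuedMaps

section Frames

variable {𝕜 : Type*} [RCLike 𝕜]
  {EM : Type*} [NormedAddCommGroup EM] [NormedSpace 𝕜 EM]
  {HM : Type*} [TopologicalSpace HM] {IM : ModelWithCorners 𝕜 EM HM}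
  {M : Type*} [TopologicalSpace M] [ChartedSpace HM M]
  {F : Type*} [NormedAddCommGroup F] [NormedSpace 𝕜 F]
  {E : M → Type*} [TopologicalSpace (Bundle.TotalSpace F E)]
  [∀ x, AddCommGroup (E x)] [∀ x, Module 𝕜 (E x)] [∀ x, TopologicalSpace (E x)]
  [FiberBundle F E] [VectorBundle 𝕜 F E]

lemma eventually_mem_baseSet_trivializationAt (F : Type*) [NormedAddCommGroup F]
    (E : M → Type*) [TopologicalSpace (Bundle.TotalSpace F E)] [∀ x, TopologicalSpace (E x)]
    [FiberBundle F E] (x : M) :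
    ∀ᶠ y in 𝓝 x, y ∈ (trivializationAt F E x).baseSet :=
  (trivializationAt F E x).open_baseSet.mem_nhds (FiberBundle.mem_baseSet_trivializationAt' x)

variable (IM) in
lemma eventually_mvfderiv_extChartAt [IsManifold IM 1 M] (x : M) : ∀ᶠ y in 𝓝 x,
    (mvfderiv IM (extChartAt IM x) y : TangentSpace IM y →L[𝕜] EM)
      = (trivializationAt EM (TangentSpace IM) x).continuousLinearMapAt 𝕜 y := by
  filter_upwards [(chartAt HM x).open_source.mem_nhds (mem_chart_source HM x)] with y hy
  exact (TangentBundle.continuousLinearMapAt_trivializationAt hy).symm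

variable {EG : Type*} [NormedAddCommGroup EG] [NormedSpace 𝕜 EG]
  {HG : Type*} [TopologicalSpace HG] {IG : ModelWithCorners 𝕜 EG HG}
  {G : Type*} [TopologicalSpace G] [ChartedSpace HG G] [Group G]
  {φ : G →* (F ≃L[𝕜] F)} {ι : Type*}

namespace GStructure

variable (P : GStructure IM IG E φ ι) {i : ι} {x y : M}

/-- The frame `frame i` read in the preferred trivialization of `E` at `x`. -/
def frameCoord (i : ι) (x y : M) : F →L[𝕜] F :=
  (trivializationAt F E x).continuousLinearMapAt 𝕜 y ∘L (P.frame i y : F →L[𝕜] E y)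

lemma trivializationAt_frame (hy : y ∈ (trivializationAt F E x).baseSet) (ξ : F) :
    (trivializationAt F E x ⟨y, P.frame i y ξ⟩).2 = P.frameCoord i x y ξ := by
  simp [frameCoord, Bundle.Trivialization.coe_linearMapAt_of_mem _ hy]

lemma frameCoord_eq (hy : y ∈ (trivializationAt F E x).baseSet) :
    P.frameCoord i x y = (((P.frame i y).trans
      ((trivializationAt F E x).continuousLinearEquivAt 𝕜 y hy) : F ≃L[𝕜] F) : F →L[𝕜] F) := by
  ext ξ
  simp [frameCoord, Bundle.Trivialization.coe_linearMapAt_of_mem _ hy]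

lemma inverse_frameCoord_apply (hy : y ∈ (trivializationAt F E x).baseSet) (e : E y) :
    (P.frameCoord i x y).inverse ((trivializationAt F E x).continuousLinearMapAt 𝕜 y e)
      = (P.frame i y).symm e := by
  rw [P.frameCoord_eq hy, ContinuousLinearMap.inverse_equiv,
    ← Bundle.Trivialization.coe_continuousLinearEquivAt_eq _ hy]
  simp only [ContinuousLinearEquiv.coe_coe, ContinuousLinearEquiv.symm_trans_apply,
    ContinuousLinearEquiv.symm_apply_apply]

variable [FiniteDimensional 𝕜 F]

lemma contMDiffAt_frameCoord (hx : x ∈ P.baseSet i) :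
    ContMDiffAt IM 𝓘(𝕜, F →L[𝕜] F) ∞ (P.frameCoord i x) x := by
  refine contMDiffAt_clm_of_apply fun ξ ↦ ?_
  have h := (P.contMDiffOn_frame i ξ).contMDiffAt ((P.isOpen_baseSet i).mem_nhds hx)
  rw [Bundle.contMDiffAt_section] at h
  refine h.congr_of_eventuallyEq ?_
  filter_upwards [eventually_mem_baseSet_trivializationAt F E x] with y hy
  exact (P.trivializationAt_frame hy ξ).symm

lemma contMDiffAt_inverse_frameCoord (hx : x ∈ P.baseSet i) :
    ContMDiffAt IM 𝓘(𝕜, F →L[𝕜] F) ∞ (fun y ↦ (P.frameCoord i x y).inverse) x := by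
  have : CompleteSpace F := FiniteDimensional.complete 𝕜 F
  have h := contDiffAt_map_inverse (𝕜 := 𝕜) (n := ∞) ((P.frame i x).trans
    ((trivializationAt F E x).continuousLinearEquivAt 𝕜 x
      (FiberBundle.mem_baseSet_trivializationAt' x)))
  rw [← P.frameCoord_eq] at h
  exact h.contMDiffAt.comp x (P.contMDiffAt_frameCoord hx)

section AlongMap

variable {EN : Type*} [NormedAddCommGroup EN] [NormedSpace 𝕜 EN]
  {HN : Type*} [TopologicalSpace HN] {J : ModelWithCorners 𝕜 EN HN}
  {N : Type*} [TopologicalSpace N] [ChartedSpace HN N] {b : N → M} {z : N} {n : ℕ∞}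

lemma contMDiffAt_frame_apply (hz : b z ∈ P.baseSet i) (hb : ContMDiffAt J IM n b z)
    {h : N → F} (hh : ContMDiffAt J 𝓘(𝕜, F) n h z) :
    ContMDiffAt J (IM.prod 𝓘(𝕜, F)) n
      (fun y ↦ Bundle.TotalSpace.mk' F (b y) (P.frame i (b y) (h y))) z := by
  rw [Bundle.contMDiffAt_totalSpace]
  refine ⟨hb, ?_⟩
  have hframe : ContMDiffAt J 𝓘(𝕜, F →L[𝕜] F) n (fun y ↦ P.frameCoord i (b z) (b y)) z :=
    ((P.contMDiffAt_frameCoord hz).of_le (by exact_mod_cast le_top)).comp z hb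
  refine (hframe.clm_apply hh).congr_of_eventuallyEq ?_
  filter_upwards [hb.continuousAt.eventually
    (eventually_mem_baseSet_trivializationAt F E (b z))] with y hy
  exact P.trivializationAt_frame hy _

lemma contMDiffAt_frame_symm_apply (hz : b z ∈ P.baseSet i) {σ : ∀ y, E (b y)}
    (hσ : ContMDiffAt J (IM.prod 𝓘(𝕜, F)) n (fun y ↦ Bundle.TotalSpace.mk' F (b y) (σ y)) z) :
    ContMDiffAt J 𝓘(𝕜, F) n (fun y ↦ (P.frame i (b y)).symm (σ y)) z := by
  rw [Bundle.contMDiffAt_totalSpace] at hσ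
  have hb : ContMDiffAt J IM n b z := hσ.1
  have hframe : ContMDiffAt J 𝓘(𝕜, F →L[𝕜] F) n
      (fun y ↦ (P.frameCoord i (b z) (b y)).inverse) z :=
    ((P.contMDiffAt_inverse_frameCoord hz).of_le (by exact_mod_cast le_top)).comp z hb
  refine (hframe.clm_apply hσ.2).congr_of_eventuallyEq ?_
  filter_upwards [hb.continuousAt.eventually
    (eventually_mem_baseSet_trivializationAt F E (b z))] with y hy
  rw [← P.inverse_frameCoord_apply hy]
  simp only [Bundle.Trivialization.coe_linearMapAt_of_mem _ hy,
    Bundle.Trivialization.continuousLinearMapAt_apply]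

end AlongMap

lemma mdifferentiableAt_frame_apply (hx : x ∈ P.baseSet i) {h : M → F}
    (hh : MDifferentiableAt IM 𝓘(𝕜, F) h x) :
    MDifferentiableAt IM (IM.prod 𝓘(𝕜, F))
      (fun y ↦ Bundle.TotalSpace.mk' F y (P.frame i y (h y))) x := by
  rw [mdifferentiableAt_section (IB := IM)]
  have hframe := (P.contMDiffAt_frameCoord hx).mdifferentiableAt (n := ∞) (by simp)
  refine (hframe.clm_apply hh).congr_of_eventuallyEq ?_
  filter_upwards [eventually_mem_baseSet_trivializationAt F E x] with y hy
  exact P.trivializationAt_frame hy _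

lemma mdifferentiableAt_frame_symm_apply (hx : x ∈ P.baseSet i) {σ : ∀ y, E y}
    (hσ : MDifferentiableAt IM (IM.prod 𝓘(𝕜, F)) (fun y ↦ Bundle.TotalSpace.mk' F y (σ y)) x) :
    MDifferentiableAt IM 𝓘(𝕜, F) (fun y ↦ (P.frame i y).symm (σ y)) x := by
  rw [mdifferentiableAt_section] at hσ
  have hframe := (P.contMDiffAt_inverse_frameCoord hx).mdifferentiableAt (n := ∞) (by simp)
  refine (hframe.clm_apply hσ).congr_of_eventuallyEq ?_
  filter_upwards [eventually_mem_baseSet_trivializationAt F E x] with y hy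
  rw [← P.inverse_frameCoord_apply hy]
  simp only [Bundle.Trivialization.coe_linearMapAt_of_mem _ hy,
    Bundle.Trivialization.continuousLinearMapAt_apply]

end GStructure

end Frames

section LocalForms

variable {𝕜 : Type*} [RCLike 𝕜]
  {EM : Type*} [NormedAddCommGroup EM] [NormedSpace 𝕜 EM]
  {HM : Type*} [TopologicalSpace HM] {IM : ModelWithCorners 𝕜 EM HM}
  {M : Type*} [TopologicalSpace M] [ChartedSpace HM M]
  {F : Type*} [NormedAddCommGroup F] [NormedSpace 𝕜 F]
  {E : M → Type*} [TopologicalSpace (Bundle.TotalSpace F E)]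
  [∀ x, AddCommGroup (E x)] [∀ x, Module 𝕜 (E x)] [∀ x, TopologicalSpace (E x)]
  [FiberBundle F E]
  {EG : Type*} [NormedAddCommGroup EG] [NormedSpace 𝕜 EG]
  {HG : Type*} [TopologicalSpace HG] {IG : ModelWithCorners 𝕜 EG HG}
  {G : Type*} [TopologicalSpace G] [ChartedSpace HG G] [Group G]
  {φ : G →* (F ≃L[𝕜] F)} {ι : Type*}

lemma contDiffAt_comp_extChartAt_symm [IM.Boundaryless] {V : Type*}
    [NormedAddCommGroup V] [NormedSpace 𝕜 V] {A : M → V} {x : M}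
    (hA : ContMDiffAt IM 𝓘(𝕜, V) ∞ A x) :
    ContDiffAt 𝕜 ∞ (A ∘ (extChartAt IM x).symm) (extChartAt IM x x) := by
  have hsymm := contMDiffWithinAt_extChartAt_symm_range_self (I := IM) (n := ∞) x
  rw [IM.range_eq_univ, contMDiffWithinAt_univ] at hsymm
  exact contMDiffAt_iff_contDiffAt.1 <|
    ContMDiffAt.comp (extChartAt IM x x) (by rwa [extChartAt_to_inv]) hsymm

lemma eventually_extChartAt_symm_apply (IM : ModelWithCorners 𝕜 EM HM) (x : M) :
    ∀ᶠ y in 𝓝 x, (extChartAt IM x).symm (extChartAt IM x y) = y :=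
  Filter.mem_of_superset (extChartAt_source_mem_nhds (I := IM) x)
    fun _ hy ↦ (extChartAt IM x).left_inv hy

lemma mvfderiv_extChartAt_self [IsManifold IM 1 M] {x : M} (v : TangentSpace IM x) :
    mvfderiv IM (extChartAt IM x) x v = v :=
  congrArg (fun L : EM →L[𝕜] EM ↦ L v) mfderiv_extChartAt_self

/-- The bundle morphism `ρ : E → TM` is smooth. -/
def IsSmoothAnchor (IM : ModelWithCorners 𝕜 EM HM) (F : Type*) [NormedAddCommGroup F]
    [NormedSpace 𝕜 F] {E : M → Type*} [TopologicalSpace (Bundle.TotalSpace F E)]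
    [∀ x, AddCommGroup (E x)] [∀ x, Module 𝕜 (E x)] [∀ x, TopologicalSpace (E x)]
    [FiberBundle F E] [IsManifold IM 1 M] [VectorBundle 𝕜 F E]
    (ρ : ∀ x, E x →L[𝕜] TangentSpace IM x) : Prop :=
  ContMDiff IM (IM.prod 𝓘(𝕜, F →L[𝕜] EM)) ∞ (fun x ↦ Bundle.TotalSpace.mk' (F →L[𝕜] EM)
    (E := fun x ↦ E x →L[𝕜] TangentSpace IM x) x (ρ x))

namespace GStructure

variable (P : GStructure IM IG E φ ι) {i : ι} {x : M}

lemma eventually_mem_baseSet (hx : x ∈ P.baseSet i) : ∀ᶠ y in 𝓝 x, y ∈ P.baseSet i :=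
  (P.isOpen_baseSet i).mem_nhds hx

section Connection

variable [∀ x, IsTopologicalAddGroup (E x)] [∀ x, ContinuousSMul 𝕜 (E x)]
  (cov : CovariantDerivative IM F E)

/-- `Γ` is the connection form of `cov` with respect to `frame i`, read near `x` in the preferred
chart of `M` at `x`. -/
structure IsLocalConnectionForm (i : ι) (x : M) (Γ : EM → EM →L[𝕜] F →L[𝕜] F) : Prop where
  contDiffAt : ContDiffAt 𝕜 ∞ Γ (extChartAt IM x x)
  eventually_eq : ∀ᶠ y in 𝓝 x, ∀ (v : TangentSpace IM y) (ξ : F),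
    Γ (extChartAt IM x y) (mvfderiv IM (extChartAt IM x) y v) ξ = P.connectionForm cov i y v ξ

variable [VectorBundle 𝕜 F E] [FiniteDimensional 𝕜 F]

lemma isLinearMap_connectionForm (hx : x ∈ P.baseSet i) (v : TangentSpace IM x) :
    IsLinearMap 𝕜 (P.connectionForm cov i x v) := by
  have hframe (ξ : F) := P.mdifferentiableAt_frame_apply hx (h := fun _ ↦ ξ) mdifferentiableAt_const
  refine ⟨fun ξ η ↦ ?_, fun c ξ ↦ ?_⟩
  · have h := cov.isCovariantDerivativeOnUniv.add (hframe ξ) (hframe η)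
    rw [connectionForm, connectionForm, connectionForm, ← map_add, ← add_apply, ← h]
    simp only [map_add]
    rfl
  · have h := cov.isCovariantDerivativeOnUniv.smul_const c (hframe ξ)
    rw [connectionForm, connectionForm, ← map_smul, ← smul_apply, ← h]
    simp only [map_smul]
    rfl

theorem cov_frame_apply [ContMDiffVectorBundle 1 F E IM] (hx : x ∈ P.baseSet i) {h : M → F}
    (hh : MDifferentiableAt IM 𝓘(𝕜, F) h x) (v : TangentSpace IM x) :
    cov (fun y ↦ P.frame i y (h y)) x v
      = P.frame i x (mvfderiv IM h x v + P.connectionForm cov i x v (h x)) := by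
  -- The difference between `∇_v` and the derivative of the components is tensorial, hence can be
  -- computed on the section with constant components `h x`.
  have htensorial : TensorialAt IM F (fun σ : (∀ y, E y) ↦ cov σ x v
      - P.frame i x (mvfderiv IM (fun y ↦ (P.frame i y).symm (σ y)) x v)) x := by
    constructor
    · intro f σ hf hσ
      simp only [Pi.smul_apply', map_smul]
      rw [cov.isCovariantDerivativeOnUniv.leibniz hσ hf,
        mvfderiv_fun_smul hf (P.mdifferentiableAt_frame_symm_apply hx hσ)]
      simp only [add_apply, smul_apply, map_add, map_smul, ContinuousLinearMap.smulRight_apply,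
        ContinuousLinearEquiv.apply_symm_apply]
      module
    · intro σ σ' hσ hσ'
      simp only [Pi.add_apply, map_add]
      rw [cov.isCovariantDerivativeOnUniv.add hσ hσ',
        mvfderiv_fun_add (P.mdifferentiableAt_frame_symm_apply hx hσ)
          (P.mdifferentiableAt_frame_symm_apply hx hσ')]
      simp only [add_apply, map_add]
      abel
  have h := htensorial.pointwise (P.mdifferentiableAt_frame_apply hx hh)
    (P.mdifferentiableAt_frame_apply hx (h := fun _ ↦ h x) mdifferentiableAt_const) rfl
  simp only [ContinuousLinearEquiv.symm_apply_apply, mvfderiv_const, zero_apply, map_zero,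
    sub_zero] at h
  rw [map_add, connectionForm, ContinuousLinearEquiv.apply_symm_apply, ← h]
  abel

variable [IsManifold IM ∞ M] {cov}

theorem exists_isLocalConnectionForm [IM.Boundaryless] (hcov : IsSmoothConnection IM cov)
    (hx : x ∈ P.baseSet i) : ∃ Γ, P.IsLocalConnectionForm cov i x Γ := by
  let β : F → M → EM →L[𝕜] F := fun ξ y ↦ (P.frameCoord i x y).inverse ∘L
    ContinuousLinearMap.inCoordinates EM (TangentSpace IM) F E x y x y
      (cov (fun y ↦ P.frame i y ξ) y)
  have hβ (ξ : F) : ContMDiffAt IM 𝓘(𝕜, EM →L[𝕜] F) ∞ (β ξ) x := by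
    have h := ((hcov _ (P.isOpen_baseSet i)).contMDiff (P.contMDiffOn_frame i ξ)).contMDiffAt
      ((P.isOpen_baseSet i).mem_nhds hx)
    rw [contMDiffAt_hom_bundle] at h
    exact (P.contMDiffAt_inverse_frameCoord hx).clm_comp h.2
  have hβ_apply : ∀ᶠ y in 𝓝 x, ∀ (v : EM) (ξ : F), β ξ y v
      = P.connectionForm cov i y ((trivializationAt EM (TangentSpace IM) x).symmL 𝕜 y v) ξ := by
    filter_upwards [eventually_mem_baseSet_trivializationAt F E x] with y hy v ξ
    simp only [β, ContinuousLinearMap.inCoordinates, ContinuousLinearMap.comp_apply]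
    exact P.inverse_frameCoord_apply hy _
  have hβ_linear : ∀ᶠ y in 𝓝 x, IsLinearMap 𝕜 fun ξ ↦ β ξ y := by
    filter_upwards [hβ_apply, P.eventually_mem_baseSet hx] with y hy hyi
    exact ⟨fun ξ η ↦ ContinuousLinearMap.ext fun v ↦ by
        simp only [hy, add_apply, (P.isLinearMap_connectionForm cov hyi _).map_add],
      fun c ξ ↦ ContinuousLinearMap.ext fun v ↦ by
        simp only [hy, smul_apply, (P.isLinearMap_connectionForm cov hyi _).map_smul]⟩
  obtain ⟨A, hA, hAβ⟩ := exists_contMDiffAt_clm hβ hβ_linear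
  refine ⟨fun ζ ↦ (A ((extChartAt IM x).symm ζ)).flip, ?_, ?_⟩
  · exact ((ContinuousLinearMap.flipₗᵢ 𝕜 F EM F).contDiff.contDiffAt.comp _
      (contDiffAt_comp_extChartAt_symm hA) :)
  · filter_upwards [eventually_extChartAt_symm_apply IM x, hAβ, hβ_apply,
      eventually_mem_baseSet_trivializationAt EM (TangentSpace IM) x,
      eventually_mvfderiv_extChartAt IM x] with y hsymm hAβ hβ hy hderiv v ξ
    rw [hsymm, ContinuousLinearMap.flip_apply, hAβ, hβ, hderiv,
      Bundle.Trivialization.symmL_continuousLinearMapAt _ hy]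

end Connection

/-- `r` is the anchor `ρ : E → TM` with respect to `frame i`, read near `x` in the preferred chart
of `M` at `x`. -/
structure IsLocalAnchor (ρ : ∀ x, E x →L[𝕜] TangentSpace IM x) (i : ι) (x : M)
    (r : EM → F →L[𝕜] EM) : Prop where
  contDiffAt : ContDiffAt 𝕜 ∞ r (extChartAt IM x x)
  eventually_eq : ∀ᶠ y in 𝓝 x, ∀ ξ : F,
    mvfderiv IM (extChartAt IM x) y (ρ y (P.frame i y ξ)) = r (extChartAt IM x y) ξ

variable {P} in
lemma IsLocalAnchor.eventually_eq_apply {ρ : ∀ x, E x →L[𝕜] TangentSpace IM x}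
    {r : EM → F →L[𝕜] EM} (hr : P.IsLocalAnchor ρ i x r) :
    ∀ᶠ y in 𝓝 x, ∀ e : E y, mvfderiv IM (extChartAt IM x) y (ρ y e)
      = r (extChartAt IM x y) ((P.frame i y).symm e) := by
  filter_upwards [hr.eventually_eq] with y hy e
  rw [← hy, ContinuousLinearEquiv.apply_symm_apply]

theorem exists_isLocalAnchor [IM.Boundaryless] [IsManifold IM ∞ M] [FiniteDimensional 𝕜 F]
    [VectorBundle 𝕜 F E] {ρ : ∀ x, E x →L[𝕜] TangentSpace IM x} (hρ : IsSmoothAnchor IM F ρ)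
    (hx : x ∈ P.baseSet i) : ∃ r, P.IsLocalAnchor ρ i x r := by
  have hρx := hρ x
  rw [contMDiffAt_hom_bundle] at hρx
  refine ⟨_, contDiffAt_comp_extChartAt_symm (hρx.2.clm_comp (P.contMDiffAt_frameCoord hx)), ?_⟩
  filter_upwards [eventually_extChartAt_symm_apply IM x,
    eventually_mem_baseSet_trivializationAt F E x, eventually_mvfderiv_extChartAt IM x]
    with y hsymm hy hderiv ξ
  rw [hderiv, Function.comp_apply, hsymm]
  simp only [ContinuousLinearMap.inCoordinates, frameCoord, ContinuousLinearMap.comp_apply]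
  rw [Bundle.Trivialization.symmL_continuousLinearMapAt _ hy]
  rfl

end GStructure

variable [VectorBundle 𝕜 F E] {x : M}

lemma IsSmoothAnchor.mdifferentiableAt_apply [IsManifold IM 1 M]
    {ρ : ∀ x, E x →L[𝕜] TangentSpace IM x} (hρ : IsSmoothAnchor IM F ρ)
    {σ : ∀ y, E y} (hσ : MDiffAt (T% σ) x) :
    MDiffAt (T% fun y ↦ ρ y (σ y)) x :=
  ((hρ x).mdifferentiableAt (by simp)).clm_bundle_apply hσ

lemma IsSmoothAnchor.contMDiffAt_apply [IsManifold IM 1 M]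
    {ρ : ∀ x, E x →L[𝕜] TangentSpace IM x} (hρ : IsSmoothAnchor IM F ρ)
    {n : ℕ∞} {σ : ∀ y, E y} (hσ : CMDiffAt n (T% σ) x) :
    CMDiffAt n (T% fun y ↦ ρ y (σ y)) x :=
  ((hρ x).of_le (by exact_mod_cast le_top)).clm_bundle_apply hσ

namespace GStructure

variable [∀ x, IsTopologicalAddGroup (E x)] [∀ x, ContinuousSMul 𝕜 (E x)]
  [FiniteDimensional 𝕜 F] [ContMDiffVectorBundle ∞ F E IM]
  {P : GStructure IM IG E φ ι} {i : ι} {cov : CovariantDerivative IM F E}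
  {Γ : EM → EM →L[𝕜] F →L[𝕜] F} {ρ : ∀ x, E x →L[𝕜] TangentSpace IM x} {r : EM → F →L[𝕜] EM}
  {σ τ : ∀ y, E y}

lemma IsLocalConnectionForm.eventually_cov (hΓ : P.IsLocalConnectionForm cov i x Γ)
    (hx : x ∈ P.baseSet i) :
    ∀ᶠ y in 𝓝 x, ∀ (σ : ∀ y, E y), MDiffAt (T% σ) y → ∀ v : TangentSpace IM y,
      cov σ y v = P.frame i y (covDerivAlong IM (extChartAt IM x) Γ
        (fun y ↦ (P.frame i y).symm (σ y)) y v) := by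
  filter_upwards [hΓ.eventually_eq, P.eventually_mem_baseSet hx] with y hΓy hy σ hσ v
  have h := P.cov_frame_apply cov hy (P.mdifferentiableAt_frame_symm_apply hy hσ) v
  simp only [ContinuousLinearEquiv.apply_symm_apply] at h
  rw [h, covDerivAlong, hΓy]

variable [IsManifold IM ∞ M]

lemma IsLocalConnectionForm.cov_cov (hΓ : P.IsLocalConnectionForm cov i x Γ)
    (hx : x ∈ P.baseSet i) (hσ : CMDiffAt 2 (T% σ) x) {Y : ∀ y : M, TangentSpace IM y}
    (hY : MDiffAt (T% Y) x) (v : TangentSpace IM x) :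
    cov (fun y ↦ cov σ y (Y y)) x v = P.frame i x (covDerivAlong IM (extChartAt IM x) Γ
      (fun y ↦ covDerivAlong IM (extChartAt IM x) Γ (fun y ↦ (P.frame i y).symm (σ y)) y (Y y))
      x v) := by
  have hσY : ∀ᶠ y in 𝓝 x, cov σ y (Y y) = P.frame i y (covDerivAlong IM (extChartAt IM x) Γ
      (fun y ↦ (P.frame i y).symm (σ y)) y (Y y)) := by
    filter_upwards [hΓ.eventually_cov hx, (contMDiffAt_iff_contMDiffAt_nhds (by simp)).1 hσ]
      with y hy hσy
    exact hy σ (hσy.mdifferentiableAt two_ne_zero) _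
  have hdiff := P.mdifferentiableAt_frame_apply hx <| mdifferentiableAt_covDerivAlong
    contMDiffAt_extChartAt (hΓ.contDiffAt.differentiableAt (by simp))
    (P.contMDiffAt_frame_symm_apply hx (n := 2) hσ) hY
  rw [cov.isCovariantDerivativeOnUniv.congr_of_eventuallyEq
    (hdiff.congr_of_eventuallyEq (hσY.mono fun y hy ↦ congrArg _ hy)) hdiff Filter.univ_mem hσY]
  simp only [hΓ.eventually_cov hx |>.self_of_nhds _ hdiff v,
    ContinuousLinearEquiv.symm_apply_apply]

variable [IM.Boundaryless] [CompleteSpace EM]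

theorem IsLocalConnectionForm.cov_commutator (hΓ : P.IsLocalConnectionForm cov i x Γ)
    (hx : x ∈ P.baseSet i) (hσ : CMDiffAt 2 (T% σ) x) {X Y : ∀ y : M, TangentSpace IM y}
    (hX : MDiffAt (T% X) x) (hY : MDiffAt (T% Y) x) :
    cov (fun y ↦ cov σ y (Y y)) x (X x) - cov (fun y ↦ cov σ y (X y)) x (Y x)
        - cov σ x (VectorField.mlieBracket IM X Y x)
      = P.frame i x (localCurvature Γ (extChartAt IM x x) (X x) (Y x)
          ((P.frame i x).symm (σ x))) := by
  have h := covDerivAlong_commutator (q := extChartAt IM x) contMDiffAt_extChartAt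
    (hΓ.contDiffAt.differentiableAt (by simp))
    (P.contMDiffAt_frame_symm_apply hx (n := 2) hσ) hX hY
  rw [mvfderiv_extChartAt_self, mvfderiv_extChartAt_self] at h
  rw [hΓ.cov_cov hx hσ hY, hΓ.cov_cov hx hσ hX,
    hΓ.eventually_cov hx |>.self_of_nhds σ (hσ.mdifferentiableAt two_ne_zero), ← map_sub, ← map_sub,
    h]

theorem IsLocalConnectionForm.torsion_apply (hΓ : P.IsLocalConnectionForm cov i x Γ)
    (hr : P.IsLocalAnchor ρ i x r) (hρ : IsSmoothAnchor IM F ρ) (hx : x ∈ P.baseSet i)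
    (hσ : MDiffAt (T% σ) x) (hτ : MDiffAt (T% τ) x) :
    ρ x (cov τ x (ρ x (σ x)) - cov σ x (ρ x (τ x)))
        - VectorField.mlieBracket IM (fun y ↦ ρ y (σ y)) (fun y ↦ ρ y (τ y)) x
      = localTorsion Γ r (extChartAt IM x x)
          ((P.frame i x).symm (σ x)) ((P.frame i x).symm (τ x)) := by
  have hbracket := mvfderiv_mlieBracket_eq_sub_localTorsion (Γ := Γ) (q := extChartAt IM x)
    contMDiffAt_extChartAt (hr.contDiffAt.differentiableAt (by simp))
    (P.mdifferentiableAt_frame_symm_apply hx hσ) (P.mdifferentiableAt_frame_symm_apply hx hτ)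
    (hρ.mdifferentiableAt_apply hσ) (hρ.mdifferentiableAt_apply hτ)
    (hr.eventually_eq_apply.mono fun y hy ↦ hy (σ y))
    (hr.eventually_eq_apply.mono fun y hy ↦ hy (τ y))
  rw [mvfderiv_extChartAt_self] at hbracket
  rw [hΓ.eventually_cov hx |>.self_of_nhds σ hσ, hΓ.eventually_cov hx |>.self_of_nhds τ hτ,
    ← map_sub, ← mvfderiv_extChartAt_self (ρ x _), hr.eventually_eq.self_of_nhds, hbracket]
  exact sub_sub_cancel _ _

theorem IsLocalConnectionForm.connectionCurvature_eq (hΓ : P.IsLocalConnectionForm cov i x Γ)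
    (hx : x ∈ P.baseSet i) (v w : TangentSpace IM x) (e : E x) :
    connectionCurvature IM cov x v w e
      = P.frame i x (localCurvature Γ (extChartAt IM x x) v w ((P.frame i x).symm e)) := by
  have h := hΓ.cov_commutator hx (FiberBundle.contMDiffAt_extend IM F e)
    (FiberBundle.mdifferentiableAt_extend IM EM v) (FiberBundle.mdifferentiableAt_extend IM EM w)
  simp only [FiberBundle.extend_apply_self] at h
  exact h

theorem IsLocalConnectionForm.anchoredTorsion_eq (hΓ : P.IsLocalConnectionForm cov i x Γ)
    (hr : P.IsLocalAnchor ρ i x r) (hρ : IsSmoothAnchor IM F ρ) (hx : x ∈ P.baseSet i) (e f : E x) :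
    anchoredTorsion IM cov ρ x e f
      = localTorsion Γ r (extChartAt IM x x) ((P.frame i x).symm e) ((P.frame i x).symm f) := by
  have h := hΓ.torsion_apply hr hρ hx (FiberBundle.mdifferentiableAt_extend IM F e)
    (FiberBundle.mdifferentiableAt_extend IM F f)
  simp only [FiberBundle.extend_apply_self] at h
  exact h

end GStructure

end LocalForms

section Bianchi

open VectorField

variable {𝕜 : Type*} [RCLike 𝕜]
  {EM : Type*} [NormedAddCommGroup EM] [NormedSpace 𝕜 EM]
  {HM : Type*} [TopologicalSpace HM] {IM : ModelWithCorners 𝕜 EM HM}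
  {M : Type*} [TopologicalSpace M] [ChartedSpace HM M]
  {F : Type*} [NormedAddCommGroup F] [NormedSpace 𝕜 F]
  {E : M → Type*} [TopologicalSpace (Bundle.TotalSpace F E)]
  [∀ x, AddCommGroup (E x)] [∀ x, Module 𝕜 (E x)] [∀ x, TopologicalSpace (E x)]
  [∀ x, IsTopologicalAddGroup (E x)] [∀ x, ContinuousSMul 𝕜 (E x)]
  [FiberBundle F E] [VectorBundle 𝕜 F E]
  {cov : CovariantDerivative IM F E} {ρ : ∀ x, E x →L[𝕜] TangentSpace IM x}
  {σ τ υ : ∀ y, E y} {x : M} {X Y Z : ∀ y : M, TangentSpace IM y}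

lemma mlieBracket_mlieBracket_add [IsManifold IM 3 M] [CompleteSpace EM]
    (hX : CMDiffAt 2 (T% X) x) (hY : CMDiffAt 2 (T% Y) x) (hZ : CMDiffAt 2 (T% Z) x) :
    mlieBracket IM (mlieBracket IM X Y) Z x + mlieBracket IM (mlieBracket IM Y Z) X x
      = mlieBracket IM (mlieBracket IM X Z) Y x := by
  have : IsManifold IM (minSmoothness 𝕜 3) M := by
    rwa [minSmoothness_of_isRCLikeNormedField]
  have h := leibniz_identity_mlieBracket_apply (U := X) (V := Y) (W := Z)
    (by rwa [minSmoothness_of_isRCLikeNormedField]) (by rwa [minSmoothness_of_isRCLikeNormedField])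
    (by rwa [minSmoothness_of_isRCLikeNormedField])
  rw [mlieBracket_swap_apply, mlieBracket_swap_apply (V := Y), ← sub_eq_add_neg] at h
  rw [← sub_eq_zero, ← neg_eq_zero, ← sub_eq_zero.2 h]
  abel

lemma cov_sub_apply (hσ : MDiffAt (T% σ) x) (hτ : MDiffAt (T% τ) x) (v : TangentSpace IM x) :
    cov (fun y ↦ σ y - τ y) x v = cov σ x v - cov τ x v := by
  have hneg : MDiffAt (T% fun y ↦ (-1 : 𝕜) • τ y) x :=
    mdifferentiableAt_const (c := (-1 : 𝕜)).smul_section hτ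
  have hadd := cov.isCovariantDerivativeOnUniv.add hσ hneg
  have hsmul := cov.isCovariantDerivativeOnUniv.smul_const (-1 : 𝕜) hτ
  simp only [Pi.add_def, Pi.neg_def, neg_one_smul, ← sub_eq_add_neg] at hadd hsmul
  rw [hadd, add_apply, hsmul, neg_apply, sub_eq_add_neg]

/-- The bracket `∇_{ρσ} τ - ∇_{ρτ} σ` of two sections of `E`, which the anchor maps to `[ρσ, ρτ]`
when the torsion vanishes. -/
def anchoredBracket (cov : CovariantDerivative IM F E) (ρ : ∀ x, E x →L[𝕜] TangentSpace IM x)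
    (σ τ : ∀ y, E y) (y : M) : E y :=
  cov τ y (ρ y (σ y)) - cov σ y (ρ y (τ y))

variable {EG : Type*} [NormedAddCommGroup EG] [NormedSpace 𝕜 EG]
  {HG : Type*} [TopologicalSpace HG] {IG : ModelWithCorners 𝕜 EG HG}
  {G : Type*} [TopologicalSpace G] [ChartedSpace HG G] [Group G]
  {φ : G →* (F ≃L[𝕜] F)} {ι : Type*} (P : GStructure IM IG E φ ι)
  [FiniteDimensional 𝕜 F] [IsManifold IM ∞ M] [ContMDiffVectorBundle ∞ F E IM] [IM.Boundaryless]

namespace GStructure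

include P in
lemma mdifferentiableAt_cov_apply (hcov : IsSmoothConnection IM cov) (hσ : CMDiffAt 2 (T% σ) x)
    (hX : MDiffAt (T% X) x) : MDiffAt (T% fun y ↦ cov σ y (X y)) x := by
  have hx := P.mem_baseSet_at x
  obtain ⟨Γ, hΓ⟩ := P.exists_isLocalConnectionForm hcov hx
  refine (P.mdifferentiableAt_frame_apply hx <| mdifferentiableAt_covDerivAlong
    contMDiffAt_extChartAt (hΓ.contDiffAt.differentiableAt (by simp))
    (P.contMDiffAt_frame_symm_apply hx (n := 2) hσ) hX).congr_of_eventuallyEq ?_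
  filter_upwards [hΓ.eventually_cov hx, (contMDiffAt_iff_contMDiffAt_nhds (by simp)).1 hσ]
    with y hy hσy
  exact congrArg _ (hy σ (hσy.mdifferentiableAt two_ne_zero) _)

include P in
lemma mdifferentiableAt_anchoredBracket (hcov : IsSmoothConnection IM cov)
    (hρ : IsSmoothAnchor IM F ρ) (hσ : CMDiffAt 2 (T% σ) x) (hτ : CMDiffAt 2 (T% τ) x) :
    MDiffAt (T% (anchoredBracket cov ρ σ τ)) x :=
  mdifferentiableAt_sub_section
    (P.mdifferentiableAt_cov_apply hcov hτ
      (hρ.mdifferentiableAt_apply (hσ.mdifferentiableAt two_ne_zero)))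
    (P.mdifferentiableAt_cov_apply hcov hσ
      (hρ.mdifferentiableAt_apply (hτ.mdifferentiableAt two_ne_zero)))

include P in
lemma cov_anchoredBracket (hcov : IsSmoothConnection IM cov) (hρ : IsSmoothAnchor IM F ρ)
    (hσ : CMDiffAt 2 (T% σ) x) (hτ : CMDiffAt 2 (T% τ) x) (v : TangentSpace IM x) :
    cov (anchoredBracket cov ρ σ τ) x v
      = cov (fun y ↦ cov τ y (ρ y (σ y))) x v - cov (fun y ↦ cov σ y (ρ y (τ y))) x v :=
  cov_sub_apply
    (P.mdifferentiableAt_cov_apply hcov hτ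
      (hρ.mdifferentiableAt_apply (hσ.mdifferentiableAt two_ne_zero)))
    (P.mdifferentiableAt_cov_apply hcov hσ
      (hρ.mdifferentiableAt_apply (hτ.mdifferentiableAt two_ne_zero))) v

variable [CompleteSpace EM]

include P in
theorem connectionCurvature_apply (hcov : IsSmoothConnection IM cov) (hσ : CMDiffAt 2 (T% σ) x)
    (hX : MDiffAt (T% X) x) (hY : MDiffAt (T% Y) x) :
    connectionCurvature IM cov x (X x) (Y x) (σ x) =
      cov (fun y ↦ cov σ y (Y y)) x (X x) - cov (fun y ↦ cov σ y (X y)) x (Y x)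
        - cov σ x (mlieBracket IM X Y x) := by
  have hx := P.mem_baseSet_at x
  obtain ⟨Γ, hΓ⟩ := P.exists_isLocalConnectionForm hcov hx
  rw [hΓ.cov_commutator hx hσ hX hY, hΓ.connectionCurvature_eq hx]

include P in
theorem anchoredTorsion_apply (hcov : IsSmoothConnection IM cov) (hρ : IsSmoothAnchor IM F ρ)
    (hσ : MDiffAt (T% σ) x) (hτ : MDiffAt (T% τ) x) :
    anchoredTorsion IM cov ρ x (σ x) (τ x) =
      ρ x (anchoredBracket cov ρ σ τ x)
        - mlieBracket IM (fun y ↦ ρ y (σ y)) (fun y ↦ ρ y (τ y)) x := by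
  have hx := P.mem_baseSet_at x
  obtain ⟨Γ, hΓ⟩ := P.exists_isLocalConnectionForm hcov hx
  obtain ⟨r, hr⟩ := P.exists_isLocalAnchor hρ hx
  rw [hΓ.anchoredTorsion_eq hr hρ hx, ← hΓ.torsion_apply hr hρ hx hσ hτ, anchoredBracket]

include P in
lemma mlieBracket_anchor (hcov : IsSmoothConnection IM cov) (hρ : IsSmoothAnchor IM F ρ)
    (hT : ∀ x e₁ e₂, anchoredTorsion IM cov ρ x e₁ e₂ = 0)
    (hσ : MDiffAt (T% σ) x) (hτ : MDiffAt (T% τ) x) :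
    mlieBracket IM (fun y ↦ ρ y (σ y)) (fun y ↦ ρ y (τ y)) x
      = ρ x (anchoredBracket cov ρ σ τ x) := by
  rw [eq_comm, ← sub_eq_zero, ← P.anchoredTorsion_apply hcov hρ hσ hτ, hT]

include P in
lemma mlieBracket_mlieBracket_anchor (hcov : IsSmoothConnection IM cov)
    (hρ : IsSmoothAnchor IM F ρ) (hT : ∀ x e₁ e₂, anchoredTorsion IM cov ρ x e₁ e₂ = 0)
    (hσ : CMDiffAt 2 (T% σ) x) (hτ : CMDiffAt 2 (T% τ) x) (hυ : MDiffAt (T% υ) x) :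
    mlieBracket IM (mlieBracket IM (fun y ↦ ρ y (σ y)) (fun y ↦ ρ y (τ y)))
        (fun y ↦ ρ y (υ y)) x
      = ρ x (anchoredBracket cov ρ (anchoredBracket cov ρ σ τ) υ x) := by
  have hbracket : mlieBracket IM (fun y ↦ ρ y (σ y)) (fun y ↦ ρ y (τ y))
      =ᶠ[𝓝 x] fun y ↦ ρ y (anchoredBracket cov ρ σ τ y) := by
    filter_upwards [(contMDiffAt_iff_contMDiffAt_nhds (by simp)).1 hσ,
      (contMDiffAt_iff_contMDiffAt_nhds (by simp)).1 hτ] with y hσy hτy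
    exact P.mlieBracket_anchor hcov hρ hT (hσy.mdifferentiableAt two_ne_zero)
      (hτy.mdifferentiableAt two_ne_zero)
  refine (hbracket.mlieBracket_vectorField_eq (.refl _ fun y ↦ ρ y (υ y))).trans ?_
  exact P.mlieBracket_anchor hcov hρ hT (P.mdifferentiableAt_anchoredBracket hcov hρ hσ hτ) hυ

include P in
lemma connectionCurvature_anchor (hcov : IsSmoothConnection IM cov) (hρ : IsSmoothAnchor IM F ρ)
    (hT : ∀ x e₁ e₂, anchoredTorsion IM cov ρ x e₁ e₂ = 0)
    (hσ : MDiffAt (T% σ) x) (hτ : MDiffAt (T% τ) x) (hυ : CMDiffAt 2 (T% υ) x) :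
    connectionCurvature IM cov x (ρ x (σ x)) (ρ x (τ x)) (υ x)
      = cov (fun y ↦ cov υ y (ρ y (τ y))) x (ρ x (σ x))
        - cov (fun y ↦ cov υ y (ρ y (σ y))) x (ρ x (τ x))
        - cov υ x (ρ x (anchoredBracket cov ρ σ τ x)) := by
  have h := P.connectionCurvature_apply hcov hυ (hρ.mdifferentiableAt_apply hσ)
    (hρ.mdifferentiableAt_apply hτ)
  rwa [P.mlieBracket_anchor hcov hρ hT hσ hτ] at h

include P in
theorem anchor_cyclic_curvature_eq_zero (hcov : IsSmoothConnection IM cov)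
    (hρ : IsSmoothAnchor IM F ρ) (hT : ∀ x e₁ e₂, anchoredTorsion IM cov ρ x e₁ e₂ = 0)
    (x : M) (e₁ e₂ e₃ : E x) :
    ρ x (connectionCurvature IM cov x (ρ x e₁) (ρ x e₂) e₃
      + connectionCurvature IM cov x (ρ x e₂) (ρ x e₃) e₁
      + connectionCurvature IM cov x (ρ x e₃) (ρ x e₁) e₂) = 0 := by
  let s (e : E x) : ∀ y, E y := FiberBundle.extend F e
  have hs (e : E x) : CMDiffAt 2 (T% (s e)) x := FiberBundle.contMDiffAt_extend IM F e
  have hs' (e : E x) : MDiffAt (T% (s e)) x := (hs e).mdifferentiableAt two_ne_zero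
  have hs_self (e : E x) : s e x = e := FiberBundle.extend_apply_self F e
  have hR (e f g : E x) := P.connectionCurvature_anchor hcov hρ hT (hs' e) (hs' f) (hs g)
  have hjacobi := mlieBracket_mlieBracket_add (hρ.contMDiffAt_apply (n := 2) (hs e₁))
    (hρ.contMDiffAt_apply (n := 2) (hs e₂)) (hρ.contMDiffAt_apply (n := 2) (hs e₃))
  have hnested (e f g : E x) :=
    P.mlieBracket_mlieBracket_anchor hcov hρ hT (hs e) (hs f) (hs' g)
  rw [hnested, hnested, hnested, ← map_add, ← sub_eq_zero, ← map_sub] at hjacobi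
  simp only [hs_self] at hR
  rw [hR, hR, hR, ← neg_eq_zero, ← map_neg, ← hjacobi]
  have hswap : anchoredBracket cov ρ (s e₃) (s e₁) x = -anchoredBracket cov ρ (s e₁) (s e₃) x :=
    (neg_sub _ _).symm
  congr 1
  rw [hswap]
  simp only [map_neg, anchoredBracket.eq_1 _ _ (anchoredBracket cov ρ _ _),
    P.cov_anchoredBracket hcov hρ (hs _) (hs _), hs_self]
  abel

end GStructure

end Bianchi

section Graphs

variable {𝕜 : Type*} [RCLike 𝕜]
  {F : Type*} [NormedAddCommGroup F] [NormedSpace 𝕜 F] {p q : Submodule 𝕜 F}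

lemma isTopCompl_of_isCompl [FiniteDimensional 𝕜 F] (hpq : IsCompl p q) : p.IsTopCompl q :=
  Submodule.IsCompl.isTopCompl_of_isClosed_of_finiteDimensional hpq p.closed_of_finiteDimensional

lemma mem_graphSubspace_iff (hpq : p.IsTopCompl q) {a : p →L[𝕜] q} {f : F} :
    f ∈ graphSubspace a ↔ q.projectionOntoL p hpq.symm f = a (p.projectionOntoL q hpq f) := by
  constructor
  · rintro ⟨b, rfl⟩
    simp [Submodule.projectionOnto_apply_left, Submodule.projectionOnto_apply_right]
  · intro h
    refine ⟨p.projectionOntoL q hpq f, ?_⟩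
    simp only [LinearMap.add_apply, Submodule.subtype_apply, LinearMap.comp_apply,
      ContinuousLinearMap.coe_coe, ← h]
    exact Submodule.projection_add_projection_eq_self hpq.isCompl f

lemma eq_zero_of_eq_graphSubspace (hpq : p.IsTopCompl q) {a : p →L[𝕜] q}
    (h : p = graphSubspace a) : a = 0 := by
  ext f
  have hf : (f : F) ∈ graphSubspace a := h ▸ f.2
  rw [mem_graphSubspace_iff hpq, Submodule.projectionOntoL_apply_left,
    Submodule.projectionOntoL_apply_right] at hf
  simp [← hf]

/-- The endomorphism `f ↦ a (pr_p f)` of `F = p ⊕ q` with square zero, depending linearly on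
`a : p → q`. The transvection `1 + nilpotentOfGraph a` maps `p` to the graph of `a`. -/
def nilpotentOfGraph (hpq : p.IsTopCompl q) : (p →L[𝕜] q) →L[𝕜] F →L[𝕜] F :=
  ContinuousLinearMap.compL 𝕜 F q F q.subtypeL ∘L
    (ContinuousLinearMap.compL 𝕜 F p q).flip (p.projectionOntoL q hpq)

lemma nilpotentOfGraph_apply_coe (hpq : p.IsTopCompl q) (a : p →L[𝕜] q) (f : p) :
    nilpotentOfGraph hpq a f = a f :=
  congrArg (fun g ↦ (a g : F)) (Submodule.projectionOntoL_apply_left hpq f)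

lemma graphSubspace_eq_map (hpq : p.IsTopCompl q) (a : p →L[𝕜] q) :
    graphSubspace a = p.map (.id 𝕜 F + nilpotentOfGraph hpq a : F →L[𝕜] F).toLinearMap := by
  ext f
  constructor
  · rintro ⟨b, rfl⟩
    exact ⟨b, b.2, by simp [nilpotentOfGraph_apply_coe]⟩
  · rintro ⟨b, hb, rfl⟩
    exact ⟨⟨b, hb⟩, by simp [nilpotentOfGraph_apply_coe hpq a ⟨b, hb⟩]⟩

variable {EN : Type*} [NormedAddCommGroup EN] [NormedSpace 𝕜 EN]
  {HN : Type*} [TopologicalSpace HN] {J : ModelWithCorners 𝕜 EN HN}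
  {N : Type*} [TopologicalSpace N] [ChartedSpace HN N] {z : N} {n : ℕ∞ω}
  {V : Type*} [NormedAddCommGroup V] [NormedSpace 𝕜 V] [CompleteSpace V]

lemma contMDiffAt_clm_inverse {V' : Type*} [NormedAddCommGroup V'] [NormedSpace 𝕜 V']
    {A : N → V →L[𝕜] V'} (hA : ContMDiffAt J 𝓘(𝕜, V →L[𝕜] V') n A z)
    (hz : (A z).IsInvertible) :
    ContMDiffAt J 𝓘(𝕜, V' →L[𝕜] V) n (fun y ↦ (A y).inverse) z :=
  hz.contDiffAt_map_inverse.contMDiffAt.comp z hA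

lemma eventually_clm_isInvertible {A : N → V →L[𝕜] V} (hA : ContinuousAt A z)
    (hz : A z = .id 𝕜 V) : ∀ᶠ y in 𝓝 z, (A y).IsInvertible := by
  have h := ContinuousLinearEquiv.nhds (.refl 𝕜 V)
  rw [ContinuousLinearEquiv.coe_refl, ← hz] at h
  exact hA.eventually h

/-- A linear map whose graph `B` parametrizes is `(pr_q ∘ B) ∘ (pr_p ∘ B)⁻¹`. -/
lemma contMDiffAt_of_forall_mem_graphSubspace [CompleteSpace p] (hpq : p.IsTopCompl q)
    {a : N → p →L[𝕜] q} {B : N → p →L[𝕜] F} (hB : ContMDiffAt J 𝓘(𝕜, p →L[𝕜] F) n B z)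
    (hBz : p.projectionOntoL q hpq ∘L B z = .id 𝕜 p)
    (haB : ∀ᶠ y in 𝓝 z, ∀ f, B y f ∈ graphSubspace (a y)) :
    ContMDiffAt J 𝓘(𝕜, p →L[𝕜] q) n a z := by
  let Bp (y : N) : p →L[𝕜] p := p.projectionOntoL q hpq ∘L B y
  let Bq (y : N) : p →L[𝕜] q := q.projectionOntoL p hpq.symm ∘L B y
  have hBp : ContMDiffAt J 𝓘(𝕜, p →L[𝕜] p) n Bp z := contMDiffAt_const.clm_comp hB
  have hBq : ContMDiffAt J 𝓘(𝕜, p →L[𝕜] q) n Bq z := contMDiffAt_const.clm_comp hB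
  have hinv := contMDiffAt_clm_inverse hBp ⟨.refl 𝕜 p, hBz.symm⟩
  refine (hBq.clm_comp hinv).congr_of_eventuallyEq ?_
  filter_upwards [eventually_clm_isInvertible hBp.continuousAt hBz, haB] with y hy haBy
  have hfac : Bq y = a y ∘L Bp y :=
    ContinuousLinearMap.ext fun f ↦ (mem_graphSubspace_iff hpq).1 (haBy f)
  rw [hfac, ContinuousLinearMap.comp_assoc, hy.self_comp_inverse, ContinuousLinearMap.comp_id]

lemma mvfderiv_mem_of_eventually_mem [FiniteDimensional 𝕜 F] {b : N → F}
    (hb : MDifferentiableAt J 𝓘(𝕜, F) b z) (hp : ∀ᶠ y in 𝓝 z, b y ∈ p) (W : TangentSpace J z) :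
    mvfderiv J b z W ∈ p := by
  obtain ⟨q, hpq⟩ := p.exists_isCompl
  have hqp := (isTopCompl_of_isCompl hpq).symm
  have hzero : (fun y ↦ q.projectionOntoL p hqp (b y)) =ᶠ[𝓝 z] fun _ ↦ 0 := by
    filter_upwards [hp] with y hy using (Submodule.projectionOntoL_apply_eq_zero_iff hqp).2 hy
  have h := mvfderiv_clm_apply (mdifferentiableAt_const (c := q.projectionOntoL p hqp)) hb W
  rw [mvfderiv_congr hzero, mvfderiv_const, mvfderiv_const, zero_apply, zero_apply, zero_apply,
    zero_add] at h
  exact (Submodule.projectionOntoL_apply_eq_zero_iff hqp).1 h.symm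

end Graphs

section Grassmannian

variable {𝕜 : Type*} [RCLike 𝕜]
  {F : Type*} [NormedAddCommGroup F] [NormedSpace 𝕜 F] [FiniteDimensional 𝕜 F]
  {ES : Type*} [NormedAddCommGroup ES] [NormedSpace 𝕜 ES]
  {HS : Type*} [TopologicalSpace HS] {IS : ModelWithCorners 𝕜 ES HS}
  {S : Type*} [TopologicalSpace S] [ChartedSpace HS S]
  {incl : S → Submodule 𝕜 F} {s₀ : S}

lemma IsGrassmannianSubmanifold.contMDiffAt_of_eq_graphSubspace
    (hincl : IsGrassmannianSubmanifold IS incl) {p q : Submodule 𝕜 F} (hpq : p.IsTopCompl q)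
    {a : S → p →L[𝕜] q} (ha : ∀ᶠ s in 𝓝 s₀, incl s = graphSubspace (a s)) :
    ContMDiffAt IS 𝓘(𝕜, p →L[𝕜] q) ∞ a s₀ := by
  have : CompleteSpace p := FiniteDimensional.complete 𝕜 p
  obtain ⟨q', hq', b, hb, -, hbs⟩ := hincl.immersion s₀
  have hbs₀ : b s₀ = 0 :=
    eq_zero_of_eq_graphSubspace (isTopCompl_of_isCompl hq') hbs.self_of_nhds
  let j : p →L[𝕜] incl s₀ := (p.subtypeL + q.subtypeL ∘L a s₀).codRestrict (incl s₀)
    fun f ↦ by rw [ha.self_of_nhds]; exact ⟨f, rfl⟩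
  let B (s : S) : p →L[𝕜] F := ((incl s₀).subtypeL + q'.subtypeL ∘L b s) ∘L j
  have hB : ContMDiffAt IS 𝓘(𝕜, p →L[𝕜] F) ∞ B s₀ :=
    (contMDiffAt_const.add (contMDiffAt_const.clm_comp hb)).clm_comp contMDiffAt_const
  refine contMDiffAt_of_forall_mem_graphSubspace hpq hB ?_ ?_
  · ext f
    simp [B, hbs₀, j, Submodule.projectionOnto_apply_right]
  · filter_upwards [ha, hbs] with s has hbs f
    rw [← has, hbs]
    exact ⟨j f, rfl⟩

/-- `Φ` is a local family of endomorphisms of `F`, starting from the identity at `s₀`, which moves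
the subspace `incl s₀` to the subspaces `incl s`. The last condition expresses that `incl` is
an immersion at `s₀`. -/
structure IsMovingFrame (IS : ModelWithCorners 𝕜 ES HS) (incl : S → Submodule 𝕜 F) (s₀ : S)
    (Φ : S → F →L[𝕜] F) : Prop where
  contMDiffAt : ∀ᶠ s in 𝓝 s₀, ContMDiffAt IS 𝓘(𝕜, F →L[𝕜] F) ∞ Φ s
  apply_self : Φ s₀ = .id 𝕜 F
  eq_map : ∀ᶠ s in 𝓝 s₀, incl s = (incl s₀).map (Φ s : F →ₗ[𝕜] F)
  eq_zero_of_forall_mem : ∀ w : TangentSpace IS s₀,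
    (∀ f ∈ incl s₀, mvfderiv IS Φ s₀ w f ∈ incl s₀) → w = 0

theorem IsGrassmannianSubmanifold.exists_isMovingFrame
    (hincl : IsGrassmannianSubmanifold IS incl) (s₀ : S) :
    ∃ Φ : S → F →L[𝕜] F, IsMovingFrame IS incl s₀ Φ := by
  obtain ⟨q, hcompl, a, ha, hinj, has⟩ := hincl.immersion s₀
  have hq := isTopCompl_of_isCompl hcompl
  refine ⟨fun s ↦ .id 𝕜 F + nilpotentOfGraph hq (a s), ?_, ?_, ?_, fun w hw ↦ ?_⟩
  · filter_upwards [has.eventually_nhds] with s hs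
    exact contMDiffAt_const.add <|
      contMDiffAt_const.clm_apply (hincl.contMDiffAt_of_eq_graphSubspace hq hs)
  · simp [eq_zero_of_eq_graphSubspace hq has.self_of_nhds]
  · filter_upwards [has] with s hs
    rw [hs, graphSubspace_eq_map hq]
  · have hderiv : mvfderiv IS (fun s ↦ .id 𝕜 F + nilpotentOfGraph hq (a s)) s₀ w
        = nilpotentOfGraph hq (mvfderiv IS a s₀ w) := by
      have hda := ha.mdifferentiableAt (by simp)
      rw [mvfderiv_fun_add mdifferentiableAt_const (mdifferentiableAt_const.clm_apply hda),
        mvfderiv_const, zero_add, mvfderiv_clm_apply mdifferentiableAt_const hda, mvfderiv_const,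
        zero_apply, zero_apply, zero_add]
    apply hinj
    rw [map_zero]
    refine ContinuousLinearMap.ext fun f : incl s₀ ↦ Subtype.ext ?_
    have hf := hw f f.2
    rw [hderiv, nilpotentOfGraph_apply_coe] at hf
    exact Submodule.disjoint_def.1 hcompl.disjoint _ hf (Subtype.property _)

namespace IsMovingFrame

variable {Φ : S → F →L[𝕜] F}

omit [FiniteDimensional 𝕜 F] in
lemma contMDiffAt_self (hΦ : IsMovingFrame IS incl s₀ Φ) :
    ContMDiffAt IS 𝓘(𝕜, F →L[𝕜] F) ∞ Φ s₀ :=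
  hΦ.contMDiffAt.self_of_nhds

variable {EN : Type*} [NormedAddCommGroup EN] [NormedSpace 𝕜 EN]
  {HN : Type*} [TopologicalSpace HN] {J : ModelWithCorners 𝕜 EN HN}
  {N : Type*} [TopologicalSpace N] [ChartedSpace HN N]

theorem mvfderiv_sub_mem {κ : N → S} {z : N} (hΦ : IsMovingFrame IS incl (κ z) Φ)
    (hκ : MDifferentiableAt J IS κ z) {g : N → F} (hg : MDifferentiableAt J 𝓘(𝕜, F) g z)
    (hgκ : ∀ᶠ y in 𝓝 z, g y ∈ incl (κ y)) (W : TangentSpace J z) :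
    mvfderiv J g z W - mvfderiv IS Φ (κ z) (mfderiv J IS κ z W) (g z) ∈ incl (κ z) := by
  have : CompleteSpace F := FiniteDimensional.complete 𝕜 F
  let b (y : N) : F := (Φ (κ y)).inverse (g y)
  have hΦd := hΦ.contMDiffAt_self.mdifferentiableAt (by simp)
  have hΦκ : MDifferentiableAt J 𝓘(𝕜, F →L[𝕜] F) (fun y ↦ Φ (κ y)) z := hΦd.comp z hκ
  have hΦinv := (contMDiffAt_clm_inverse hΦ.contMDiffAt_self
    ⟨.refl 𝕜 F, hΦ.apply_self.symm⟩).mdifferentiableAt (by simp)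
  have hb : MDifferentiableAt J 𝓘(𝕜, F) b z :=
    MDifferentiableAt.clm_apply (hΦinv.comp z hκ :) hg
  have hinv := hκ.continuousAt.eventually
    (eventually_clm_isInvertible hΦ.contMDiffAt_self.continuousAt hΦ.apply_self)
  have hb_mem : ∀ᶠ y in 𝓝 z, b y ∈ incl (κ z) := by
    filter_upwards [hgκ, hinv, hκ.continuousAt.eventually hΦ.eq_map] with y hgy hinvy hmapy
    rw [hmapy] at hgy
    obtain ⟨c, hc, hcy⟩ := hgy
    rwa [show b y = c by rw [← hinvy.inverse_apply_self c]; exact congrArg _ hcy.symm]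
  have hgb : g =ᶠ[𝓝 z] fun y ↦ Φ (κ y) (b y) := by
    filter_upwards [hinv] with y hy using (hy.self_apply_inverse _).symm
  have hbz : b z = g z := by simp [b, hΦ.apply_self]
  rw [mvfderiv_congr hgb, mvfderiv_clm_apply hΦκ hb, mvfderiv_fun_comp_apply hΦd hκ,
    hΦ.apply_self, hbz, add_sub_cancel_left]
  exact mvfderiv_mem_of_eventually_mem hb hb_mem W

variable {EG : Type*} [NormedAddCommGroup EG] [NormedSpace 𝕜 EG]
  {HG : Type*} [TopologicalSpace HG] {IG : ModelWithCorners 𝕜 EG HG}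
  {G : Type*} [TopologicalSpace G] [ChartedSpace HG G] [Group G]
  {φ : G →* (F ≃L[𝕜] F)} [MulAction G S] [ContMDiffSMul IG IS ∞ G S]

theorem lieAlgebraRep_sub_mem (hφ : IsLinearLieGroup IG φ)
    (hsmul : ∀ (g : G) (s : S), incl (g • s) = (incl s).map ((φ g : F →L[𝕜] F) : F →ₗ[𝕜] F))
    {s : S} (hΦ : IsMovingFrame IS incl s Φ) (A : GroupLieAlgebra IG G) {f : F}
    (hf : f ∈ incl s) :
    lieAlgebraRep IG φ A f - mvfderiv IS Φ s (infinitesimalAction IG IS s A) f ∈ incl s := by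
  have hact : MDifferentiableAt IG IS (fun g : G ↦ g • s) 1 :=
    ((contMDiff_smul (I := IG) (I' := IS) (n := ∞) (G := G) (M := S)).comp
      (contMDiff_id.prodMk contMDiff_const)).contMDiffAt.mdifferentiableAt (by simp)
  have hφd : MDifferentiableAt IG 𝓘(𝕜, F →L[𝕜] F) (fun g : G ↦ (φ g : F →L[𝕜] F)) 1 :=
    hφ.contMDiff.contMDiffAt.mdifferentiableAt (by simp)
  have hΦ' : IsMovingFrame IS incl ((1 : G) • s) Φ := by rwa [one_smul]
  have h := hΦ'.mvfderiv_sub_mem (κ := fun g : G ↦ g • s) hact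
    (hφd.clm_apply (mdifferentiableAt_const (c := f)))
    (.of_forall fun g ↦ by rw [hsmul]; exact ⟨f, hf, rfl⟩) A
  rw [mvfderiv_clm_apply hφd mdifferentiableAt_const, mvfderiv_const] at h
  have hbase (s' : S) (hs' : s' = s) (w : ES) : (mvfderiv IS Φ s' : ES →L[𝕜] F →L[𝕜] F) w
      = (mvfderiv IS Φ s : ES →L[𝕜] F →L[𝕜] F) w := by subst hs'; rfl
  have hΦA : mvfderiv IS Φ ((1 : G) • s) (mfderiv IG IS (fun g : G ↦ g • s) 1 A)
      = mvfderiv IS Φ s (infinitesimalAction IG IS s A) := hbase _ (one_smul G s) _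
  have hφA : mvfderiv IG (fun g : G ↦ (φ g : F →L[𝕜] F)) 1 A = lieAlgebraRep IG φ A := rfl
  rw [hΦA, hφA] at h
  simpa [one_smul] using h

end IsMovingFrame

end Grassmannian

section OrbitBundleGeometry

variable {𝕜 : Type*} [RCLike 𝕜]
  {EM : Type*} [NormedAddCommGroup EM] [NormedSpace 𝕜 EM]
  {HM : Type*} [TopologicalSpace HM] {IM : ModelWithCorners 𝕜 EM HM}
  {M : Type*} [TopologicalSpace M] [ChartedSpace HM M]
  {F : Type*} [NormedAddCommGroup F] [NormedSpace 𝕜 F]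
  {E : M → Type*} [TopologicalSpace (Bundle.TotalSpace F E)]
  [∀ x, AddCommGroup (E x)] [∀ x, Module 𝕜 (E x)] [∀ x, TopologicalSpace (E x)]
  [FiberBundle F E]
  {EG : Type*} [NormedAddCommGroup EG] [NormedSpace 𝕜 EG]
  {HG : Type*} [TopologicalSpace HG] {IG : ModelWithCorners 𝕜 EG HG}
  {G : Type*} [TopologicalSpace G] [ChartedSpace HG G] [Group G]
  {φ : G →* (F ≃L[𝕜] F)} {hφ : IsLinearLieGroup IG φ}
  {ι : Type*} {P : GStructure IM IG E φ ι}

namespace GStructure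

lemma contMDiffAt_transition (hφ : IsLinearLieGroup IG φ) {i j : ι} {x : M}
    (hi : x ∈ P.baseSet i) (hj : x ∈ P.baseSet j) :
    ContMDiffAt IM 𝓘(𝕜, F →L[𝕜] F) ∞
      (fun y ↦ (φ (P.transition i j y) : F →L[𝕜] F)) x :=
  hφ.contMDiff.contMDiffAt.comp x <| (P.contMDiffOn_transition i j).contMDiffAt
    (((P.isOpen_baseSet i).inter (P.isOpen_baseSet j)).mem_nhds ⟨hi, hj⟩)

theorem connectionForm_transition [∀ x, IsTopologicalAddGroup (E x)]
    [∀ x, ContinuousSMul 𝕜 (E x)] [VectorBundle 𝕜 F E] [FiniteDimensional 𝕜 F]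
    [ContMDiffVectorBundle 1 F E IM] (hφ : IsLinearLieGroup IG φ)
    (cov : CovariantDerivative IM F E) {i j : ι} {x : M} (hi : x ∈ P.baseSet i)
    (hj : x ∈ P.baseSet j) (v : TangentSpace IM x) (ξ : F) :
    φ (P.transition i j x) (P.connectionForm cov i x v ξ)
      = mvfderiv IM (fun y ↦ (φ (P.transition i j y) : F →L[𝕜] F)) x v ξ
        + P.connectionForm cov j x v (φ (P.transition i j x) ξ) := by
  have hT := (P.contMDiffAt_transition hφ hi hj).mdifferentiableAt (by simp)
  have hTξ : MDifferentiableAt IM 𝓘(𝕜, F) (fun y ↦ φ (P.transition i j y) ξ) x :=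
    hT.clm_apply mdifferentiableAt_const
  have hcongr : cov (fun y ↦ P.frame j y (φ (P.transition i j y) ξ)) x
      = cov (fun y ↦ P.frame i y ξ) x :=
    cov.isCovariantDerivativeOnUniv.congr_of_eventuallyEq
      (P.mdifferentiableAt_frame_apply hj hTξ)
      (P.mdifferentiableAt_frame_apply hi mdifferentiableAt_const) Filter.univ_mem <| by
        filter_upwards [P.eventually_mem_baseSet hi, P.eventually_mem_baseSet hj] with y hyi hyj
        exact P.frame_transition i j y ⟨hyi, hyj⟩ ξ
  apply (P.frame j x).injective
  calc P.frame j x (φ (P.transition i j x) (P.connectionForm cov i x v ξ))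
      = cov (fun y ↦ P.frame i y ξ) x v := by
        rw [P.frame_transition i j x ⟨hi, hj⟩, connectionForm,
          ContinuousLinearEquiv.apply_symm_apply]
    _ = P.frame j x (mvfderiv IM (fun y ↦ φ (P.transition i j y) ξ) x v
          + P.connectionForm cov j x v (φ (P.transition i j x) ξ)) := by
        rw [← hcongr, P.cov_frame_apply cov hj hTξ]
    _ = _ := by
        have hderiv : mvfderiv IM (fun y ↦ φ (P.transition i j y) ξ) x v
            = mvfderiv IM (fun y ↦ (φ (P.transition i j y) : F →L[𝕜] F)) x v ξ := by
          have h := mvfderiv_clm_apply hT (mdifferentiableAt_const (c := ξ)) v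
          rwa [mvfderiv_const, zero_apply, map_zero, add_zero] at h
        rw [hderiv]

end GStructure

variable {ES : Type*} [NormedAddCommGroup ES] [NormedSpace 𝕜 ES]
  {HS : Type*} [TopologicalSpace HS] {IS : ModelWithCorners 𝕜 ES HS}
  {S : Type*} [TopologicalSpace S] [ChartedSpace HS S]
  [MulAction G S] [ContMDiffSMul IG IS ∞ G S]

namespace OrbitBundle

variable (IS S P hφ) in
/-- The trivialization of `Z` given by `frame i`. -/
def trivHomeo (i : ι) : OpenPartialHomeomorph (OrbitBundle IS S P hφ) (M × S) :=
  ((P.fiberBundleCore IS S hφ).localTriv i).toOpenPartialHomeomorph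

lemma mem_trivHomeo_source {i : ι} {z : OrbitBundle IS S P hφ} :
    z ∈ (trivHomeo hφ P IS S i).source ↔ z.proj ∈ P.baseSet i :=
  (P.fiberBundleCore IS S hφ).mem_localTriv_source i z

lemma mem_trivHomeo_target {i : ι} {p : M × S} :
    p ∈ (trivHomeo hφ P IS S i).target ↔ p.1 ∈ P.baseSet i :=
  (P.fiberBundleCore IS S hφ).mem_localTriv_target i p

lemma trivHomeo_trans_mem_atlas (i : ι) {c : OpenPartialHomeomorph (M × S) (ModelProd HM HS)}
    (hc : c ∈ atlas (ModelProd HM HS) (M × S)) :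
    (trivHomeo hφ P IS S i) ≫ₕ c ∈ atlas (ModelProd HM HS) (OrbitBundle IS S P hφ) :=
  ⟨_, ⟨_, ⟨i, rfl⟩, rfl⟩, c, hc, rfl⟩

section Smooth

variable [IsManifold IM ∞ M] [IsManifold IS ∞ S]

lemma contMDiffAt_trivHomeo {i : ι} {z : OrbitBundle IS S P hφ} (hz : z.proj ∈ P.baseSet i) :
    ContMDiffAt (IM.prod IS) (IM.prod IS) ∞ (trivHomeo hφ P IS S i) z := by
  set e := trivHomeo hφ P IS S i
  have hze : z ∈ e.source := mem_trivHomeo_source.2 hz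
  let c := chartAt (ModelProd HM HS) (e z)
  have hc : c ∈ IsManifold.maximalAtlas (IM.prod IS) ∞ (M × S) :=
    IsManifold.chart_mem_maximalAtlas _
  have hec : e ≫ₕ c ∈ IsManifold.maximalAtlas (IM.prod IS) ∞ (OrbitBundle IS S P hφ) :=
    IsManifold.subset_maximalAtlas (trivHomeo_trans_mem_atlas i (chart_mem_atlas _ _))
  have hcz : e z ∈ c.source := mem_chart_source _ _
  have hz' : z ∈ (e ≫ₕ c).source := by simp [hze, hcz]
  have h1 := contMDiffAt_of_mem_maximalAtlas hec hz'
  have h2 := contMDiffAt_symm_of_mem_maximalAtlas hc (c.map_source hcz)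
  refine (h2.comp z h1).congr_of_eventuallyEq ?_
  filter_upwards [(e ≫ₕ c).open_source.mem_nhds hz'] with y hy
  simp only [mfld_simps] at hy
  simp [hy.2]

lemma contMDiffAt_trivHomeo_symm {i : ι} {p : M × S} (hp : p.1 ∈ P.baseSet i) :
    ContMDiffAt (IM.prod IS) (IM.prod IS) ∞ (trivHomeo hφ P IS S i).symm p := by
  set e := trivHomeo hφ P IS S i
  have hpe : p ∈ e.target := mem_trivHomeo_target.2 hp
  let c := chartAt (ModelProd HM HS) p
  have hc : c ∈ IsManifold.maximalAtlas (IM.prod IS) ∞ (M × S) :=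
    IsManifold.chart_mem_maximalAtlas _
  have hec : e ≫ₕ c ∈ IsManifold.maximalAtlas (IM.prod IS) ∞ (OrbitBundle IS S P hφ) :=
    IsManifold.subset_maximalAtlas (trivHomeo_trans_mem_atlas i (chart_mem_atlas _ _))
  have hcp : p ∈ c.source := mem_chart_source _ _
  have hp' : c p ∈ (e ≫ₕ c).target := by simp [hcp, hpe]
  have h1 := contMDiffAt_of_mem_maximalAtlas hc hcp
  have h2 := contMDiffAt_symm_of_mem_maximalAtlas hec hp'
  refine (h2.comp p h1).congr_of_eventuallyEq ?_
  filter_upwards [c.open_source.mem_nhds hcp] with y hy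
  simp [hy]

lemma contMDiffAt_proj (z : OrbitBundle IS S P hφ) :
    ContMDiffAt (IM.prod IS) IM ∞ (proj : OrbitBundle IS S P hφ → M) z :=
  contMDiffAt_fst.comp z (contMDiffAt_trivHomeo (P.mem_baseSet_at z.proj))

lemma contMDiffAt_coord {i : ι} {z : OrbitBundle IS S P hφ} (hz : z.proj ∈ P.baseSet i) :
    ContMDiffAt (IM.prod IS) IS ∞ (coord i : OrbitBundle IS S P hφ → S) z :=
  contMDiffAt_snd.comp z (contMDiffAt_trivHomeo hz)

lemma mdifferentiableAt_proj (z : OrbitBundle IS S P hφ) :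
    MDifferentiableAt (IM.prod IS) IM (proj : OrbitBundle IS S P hφ → M) z :=
  (contMDiffAt_proj z).mdifferentiableAt (by simp)

lemma mdifferentiableAt_coord {i : ι} {z : OrbitBundle IS S P hφ} (hz : z.proj ∈ P.baseSet i) :
    MDifferentiableAt (IM.prod IS) IS (coord i : OrbitBundle IS S P hφ → S) z :=
  (contMDiffAt_coord hz).mdifferentiableAt (by simp)

lemma eventually_proj_mem {i : ι} {z : OrbitBundle IS S P hφ} (hz : z.proj ∈ P.baseSet i) :
    ∀ᶠ y : OrbitBundle IS S P hφ in 𝓝 z, y.proj ∈ P.baseSet i :=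
  (contMDiffAt_proj z).continuousAt.eventually ((P.isOpen_baseSet i).mem_nhds hz)

/-- The preferred chart of `M` at `x`, as a function on `Z`. -/
def baseChart (x : M) (y : OrbitBundle IS S P hφ) : EM := extChartAt IM x y.proj

lemma contMDiffAt_baseChart (z : OrbitBundle IS S P hφ) :
    ContMDiffAt (IM.prod IS) 𝓘(𝕜, EM) ∞ (baseChart z.proj : OrbitBundle IS S P hφ → EM) z :=
  contMDiffAt_extChartAt.comp z (contMDiffAt_proj z)

lemma mvfderiv_baseChart {x : M} {y : OrbitBundle IS S P hφ}
    (hy : y.proj ∈ (chartAt HM x).source) (W : TangentSpace (IM.prod IS) y) :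
    mvfderiv (IM.prod IS) (baseChart x : OrbitBundle IS S P hφ → EM) y W
      = mvfderiv IM (extChartAt IM x) y.proj (mfderiv (IM.prod IS) IM proj y W) :=
  mvfderiv_fun_comp_apply (mdifferentiableAt_extChartAt hy) (mdifferentiableAt_proj y) W

lemma mvfderiv_baseChart_self {z : OrbitBundle IS S P hφ} (W : TangentSpace (IM.prod IS) z) :
    mvfderiv (IM.prod IS) (baseChart z.proj : OrbitBundle IS S P hφ → EM) z W
      = mfderiv (IM.prod IS) IM proj z W :=
  (mvfderiv_baseChart (mem_chart_source HM z.proj) W).trans (mvfderiv_extChartAt_self _)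

end Smooth

lemma coord_eq_transition_smul {i j : ι} {z : OrbitBundle IS S P hφ} (hi : z.proj ∈ P.baseSet i)
    (hj : z.proj ∈ P.baseSet j) : z.coord j = P.transition i j z.proj • z.coord i := by
  have h : ∀ j, z.coord j = P.transition (P.indexAt z.proj) j z.proj • (show S from z.2) :=
    fun _ ↦ rfl
  rw [h j, h i, smul_smul, P.transition_mul hφ.injective (P.mem_baseSet_at z.proj) hi hj]

variable {incl : S → Submodule 𝕜 F} {z : OrbitBundle IS S P hφ} {i j : ι}

lemma frame_mem_subspace_iff
    (hsmul : ∀ (g : G) (s : S), incl (g • s) = (incl s).map ((φ g : F →L[𝕜] F) : F →ₗ[𝕜] F))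
    (hi : z.proj ∈ P.baseSet i) {f : F} :
    P.frame i z.proj f ∈ z.subspace incl ↔ f ∈ incl (z.coord i) := by
  rw [subspace_eq hsmul z hi]
  exact (P.frame i z.proj).injective.mem_set_image

lemma transition_apply_mem_iff
    (hsmul : ∀ (g : G) (s : S), incl (g • s) = (incl s).map ((φ g : F →L[𝕜] F) : F →ₗ[𝕜] F))
    (hi : z.proj ∈ P.baseSet i) (hj : z.proj ∈ P.baseSet j) {f : F} :
    φ (P.transition i j z.proj) f ∈ incl (z.coord j) ↔ f ∈ incl (z.coord i) := by
  rw [coord_eq_transition_smul hi hj, hsmul]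
  exact (φ (P.transition i j z.proj)).injective.mem_set_image

variable [IsManifold IM ∞ M] [IsManifold IS ∞ S]

lemma exists_tautological_extension [FiniteDimensional 𝕜 F]
    (hincl : IsGrassmannianSubmanifold IS incl)
    (hi : z.proj ∈ P.baseSet i) {f : F} (hf : f ∈ incl (z.coord i)) :
    ∃ g : OrbitBundle IS S P hφ → F, g z = f ∧
      ∀ᶠ y in 𝓝 z, ContMDiffAt (IM.prod IS) 𝓘(𝕜, F) ∞ g y ∧ g y ∈ incl (y.coord i) := by
  obtain ⟨Φ, hΦ⟩ := hincl.exists_isMovingFrame (z.coord i)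
  have hcoord := contMDiffAt_coord hi
  refine ⟨fun y ↦ Φ (y.coord i) f, by simp [hΦ.apply_self], ?_⟩
  filter_upwards [eventually_proj_mem hi, hcoord.continuousAt.eventually hΦ.contMDiffAt,
    hcoord.continuousAt.eventually hΦ.eq_map] with y hy hΦy hmap
  refine ⟨ContMDiffAt.clm_apply (hΦy.comp y (contMDiffAt_coord hy)) contMDiffAt_const, ?_⟩
  rw [hmap]
  exact ⟨f, hf, rfl⟩

variable [∀ x, IsTopologicalAddGroup (E x)] [∀ x, ContinuousSMul 𝕜 (E x)]

variable {cov : CovariantDerivative IM F E}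

/-- The covariant derivative of a section of the pull-back of `E` to `Z`, expressed in `frame i`:
the components `g` of the section are differentiated along `W`. -/
def pullbackCov (cov : CovariantDerivative IM F E) (i : ι) (g : OrbitBundle IS S P hφ → F)
    (z : OrbitBundle IS S P hφ) (W : TangentSpace (IM.prod IS) z) : F :=
  mvfderiv (IM.prod IS) g z W
    + P.connectionForm cov i z.proj (mfderiv (IM.prod IS) IM proj z W) (g z)

lemma eventually_pullbackCov_eq_covDerivAlong {Γ : EM → EM →L[𝕜] F →L[𝕜] F}
    (hΓ : P.IsLocalConnectionForm cov i z.proj Γ) :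
    ∀ᶠ y in 𝓝 z, ∀ (g : OrbitBundle IS S P hφ → F) (W : TangentSpace (IM.prod IS) y),
      pullbackCov cov i g y W = covDerivAlong (IM.prod IS) (baseChart z.proj) Γ g y W := by
  have hproj := (contMDiffAt_proj z).continuousAt
  filter_upwards [hproj.eventually hΓ.eventually_eq,
    hproj.eventually ((chartAt HM z.proj).open_source.mem_nhds (mem_chart_source HM z.proj))]
    with y hΓy hy g W
  rw [pullbackCov, covDerivAlong, mvfderiv_baseChart hy, baseChart, hΓy]

/-- The condition of membership in the connection `ℋ`, expressed in `frame i` only. -/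
def IsHorizontalIn (cov : CovariantDerivative IM F E) (i : ι) (z : OrbitBundle IS S P hφ)
    (W : TangentSpace (IM.prod IS) z) : Prop :=
  ∃ A : GroupLieAlgebra IG G,
    (∀ ξ : F, lieAlgebraRep IG φ A ξ =
      P.connectionForm cov i z.proj (mfderiv (IM.prod IS) IM proj z W) ξ) ∧
    mfderiv (IM.prod IS) IS (coord i) z W = -infinitesimalAction IG IS (z.coord i) A

variable [FiniteDimensional 𝕜 F] {W : TangentSpace (IM.prod IS) z}

theorem IsHorizontalIn.pullbackCov_mem (hincl : IsGrassmannianSubmanifold IS incl)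
    (hsmul : ∀ (g : G) (s : S), incl (g • s) = (incl s).map ((φ g : F →L[𝕜] F) : F →ₗ[𝕜] F))
    (hi : z.proj ∈ P.baseSet i) (hW : IsHorizontalIn cov i z W)
    {g : OrbitBundle IS S P hφ → F} (hg : MDifferentiableAt (IM.prod IS) 𝓘(𝕜, F) g z)
    (hg_mem : ∀ᶠ y in 𝓝 z, g y ∈ incl (y.coord i)) :
    pullbackCov cov i g z W ∈ incl (z.coord i) := by
  obtain ⟨Φ, hΦ⟩ := hincl.exists_isMovingFrame (z.coord i)
  obtain ⟨A, hA, hAW⟩ := hW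
  have h := add_mem (hΦ.mvfderiv_sub_mem (mdifferentiableAt_coord hi) hg hg_mem W)
    (hΦ.lieAlgebraRep_sub_mem hφ hsmul A hg_mem.self_of_nhds)
  rw [hAW, map_neg, neg_apply, hA] at h
  convert h using 1
  rw [pullbackCov]
  abel

theorem isHorizontalIn_of_forall_pullbackCov_mem (hincl : IsGrassmannianSubmanifold IS incl)
    (hsmul : ∀ (g : G) (s : S), incl (g • s) = (incl s).map ((φ g : F →L[𝕜] F) : F →ₗ[𝕜] F))
    (hcomp : P.IsCompatible cov) (hi : z.proj ∈ P.baseSet i)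
    (hW : ∀ g : OrbitBundle IS S P hφ → F, ContMDiffAt (IM.prod IS) 𝓘(𝕜, F) ∞ g z →
      (∀ᶠ y in 𝓝 z, g y ∈ incl (y.coord i)) → pullbackCov cov i g z W ∈ incl (z.coord i)) :
    IsHorizontalIn cov i z W := by
  obtain ⟨A, hA⟩ := hcomp i z.proj hi (mfderiv (IM.prod IS) IM proj z W)
  obtain ⟨Φ, hΦ⟩ := hincl.exists_isMovingFrame (z.coord i)
  refine ⟨A, hA, ?_⟩
  rw [eq_neg_iff_add_eq_zero]
  refine hΦ.eq_zero_of_forall_mem _ fun f hf ↦ ?_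
  have hcoord := contMDiffAt_coord hi
  have hΦcoord : ContMDiffAt (IM.prod IS) 𝓘(𝕜, F →L[𝕜] F) ∞
      (fun y : OrbitBundle IS S P hφ ↦ Φ (y.coord i)) z := hΦ.contMDiffAt_self.comp z hcoord
  have h := hW _ (hΦcoord.clm_apply (contMDiffAt_const (c := f))) <| by
    filter_upwards [hcoord.continuousAt.eventually hΦ.eq_map] with y hmap
    rw [hmap]
    exact ⟨f, hf, rfl⟩
  rw [pullbackCov, mvfderiv_clm_apply (hΦcoord.mdifferentiableAt (by simp))
    mdifferentiableAt_const, mvfderiv_const, mvfderiv_fun_comp_apply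
    (hΦ.contMDiffAt_self.mdifferentiableAt (by simp)) (mdifferentiableAt_coord hi),
    hΦ.apply_self, zero_apply, map_zero, add_zero, ← hA] at h
  convert sub_mem h (hΦ.lieAlgebraRep_sub_mem hφ hsmul A hf) using 1
  simp only [map_add, add_apply, ContinuousLinearMap.id_apply]
  abel

variable [VectorBundle 𝕜 F E] [ContMDiffVectorBundle 1 F E IM]

theorem pullbackCov_transition (cov : CovariantDerivative IM F E) (hi : z.proj ∈ P.baseSet i)
    (hj : z.proj ∈ P.baseSet j) {g : OrbitBundle IS S P hφ → F}
    (hg : MDifferentiableAt (IM.prod IS) 𝓘(𝕜, F) g z) (W : TangentSpace (IM.prod IS) z) :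
    pullbackCov cov j (fun y ↦ φ (P.transition i j y.proj) (g y)) z W
      = φ (P.transition i j z.proj) (pullbackCov cov i g z W) := by
  have hT := (P.contMDiffAt_transition hφ hi hj).mdifferentiableAt (by simp)
  have hTproj : MDifferentiableAt (IM.prod IS) 𝓘(𝕜, F →L[𝕜] F)
      (fun y : OrbitBundle IS S P hφ ↦ (φ (P.transition i j y.proj) : F →L[𝕜] F)) z :=
    hT.comp z (mdifferentiableAt_proj z)
  have hderiv := mvfderiv_clm_apply hTproj hg W
  rw [mvfderiv_fun_comp_apply hT (mdifferentiableAt_proj z)] at hderiv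
  simp only [ContinuousLinearEquiv.coe_coe] at hderiv
  rw [pullbackCov, pullbackCov, map_add, P.connectionForm_transition hφ cov hi hj, hderiv]
  abel

theorem mem_horizontal_of_forall_pullbackCov_mem (hincl : IsGrassmannianSubmanifold IS incl)
    (hsmul : ∀ (g : G) (s : S), incl (g • s) = (incl s).map ((φ g : F →L[𝕜] F) : F →ₗ[𝕜] F))
    (hcomp : P.IsCompatible cov) (hi : z.proj ∈ P.baseSet i)
    (hW : ∀ g : OrbitBundle IS S P hφ → F, ContMDiffAt (IM.prod IS) 𝓘(𝕜, F) ∞ g z →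
      (∀ᶠ y in 𝓝 z, g y ∈ incl (y.coord i)) → pullbackCov cov i g z W ∈ incl (z.coord i)) :
    W ∈ z.horizontal cov := by
  intro j hj
  refine isHorizontalIn_of_forall_pullbackCov_mem hincl hsmul hcomp hj fun g hg hg_mem ↦ ?_
  rw [← transition_apply_mem_iff hsmul hj hi,
    ← pullbackCov_transition cov hj hi (hg.mdifferentiableAt (by simp))]
  refine hW _ ?_ ?_
  · exact ContMDiffAt.clm_apply
      ((P.contMDiffAt_transition hφ hj hi).comp z (contMDiffAt_proj z) :) hg
  · filter_upwards [hg_mem, eventually_proj_mem hi, eventually_proj_mem hj] with y hgy hyi hyj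
    exact (transition_apply_mem_iff hsmul hyj hyi).2 hgy

theorem mem_horizontal_of_isHorizontalIn (hincl : IsGrassmannianSubmanifold IS incl)
    (hsmul : ∀ (g : G) (s : S), incl (g • s) = (incl s).map ((φ g : F →L[𝕜] F) : F →ₗ[𝕜] F))
    (hcomp : P.IsCompatible cov) (hi : z.proj ∈ P.baseSet i) (hW : IsHorizontalIn cov i z W) :
    W ∈ z.horizontal cov :=
  mem_horizontal_of_forall_pullbackCov_mem hincl hsmul hcomp hi fun _ hg hg_mem ↦
    hW.pullbackCov_mem hincl hsmul hi (hg.mdifferentiableAt (by simp)) hg_mem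

end OrbitBundle

end OrbitBundleGeometry

section AlongMap

variable {𝕜 : Type*} [RCLike 𝕜]
  {EN : Type*} [NormedAddCommGroup EN] [NormedSpace 𝕜 EN]
  {HN : Type*} [TopologicalSpace HN] {J : ModelWithCorners 𝕜 EN HN}
  {N : Type*} [TopologicalSpace N] [ChartedSpace HN N] {z : N}
  {EM : Type*} [NormedAddCommGroup EM] [NormedSpace 𝕜 EM]
  {HM : Type*} [TopologicalSpace HM] {IM : ModelWithCorners 𝕜 EM HM}
  {M : Type*} [TopologicalSpace M] [ChartedSpace HM M]

lemma exists_mdifferentiableAt_preimage {V W : Type*} [NormedAddCommGroup V] [NormedSpace 𝕜 V]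
    [FiniteDimensional 𝕜 V] [NormedAddCommGroup W] [NormedSpace 𝕜 W] [CompleteSpace W]
    {Ψ : N → V →L[𝕜] W} (hΨ : MDifferentiableAt J 𝓘(𝕜, V →L[𝕜] W) Ψ z)
    (hinj : Function.Injective (Ψ z)) {u : N → W} (hu : MDifferentiableAt J 𝓘(𝕜, W) u z)
    (hmem : ∀ᶠ y in 𝓝 z, ∃ c, Ψ y c = u y) :
    ∃ b : N → V, MDifferentiableAt J 𝓘(𝕜, V) b z ∧ ∀ᶠ y in 𝓝 z, Ψ y (b y) = u y := by
  have : CompleteSpace V := FiniteDimensional.complete 𝕜 V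
  obtain ⟨L, hleft⟩ : (Ψ z).HasLeftInverse :=
    .of_injective_of_isClosed_range_of_closedComplement_range hinj
      (Submodule.closed_of_finiteDimensional (Ψ z).range) (.of_finiteDimensional (Ψ z).range)
  have hL : L ∘L Ψ z = .id 𝕜 V := ContinuousLinearMap.ext hleft
  let K (y : N) : V →L[𝕜] V := L ∘L Ψ y
  have hK : MDifferentiableAt J 𝓘(𝕜, V →L[𝕜] V) K z := mdifferentiableAt_const.clm_comp hΨ
  have hKz : (K z).IsInvertible := ⟨.refl 𝕜 V, hL.symm⟩
  have hKinv : MDifferentiableAt J 𝓘(𝕜, V →L[𝕜] V) (fun y ↦ (K y).inverse) z :=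
    (hKz.contDiffAt_map_inverse.contMDiffAt.mdifferentiableAt one_ne_zero).comp z hK
  refine ⟨fun y ↦ (K y).inverse (L (u y)),
    hKinv.clm_apply (mdifferentiableAt_const.clm_apply hu), ?_⟩
  filter_upwards [hmem, eventually_clm_isInvertible hK.continuousAt hL] with y ⟨c, hc⟩ hKy
  rw [← hc]
  exact congrArg (Ψ y) (hKy.inverse_apply_self c)

variable {ES : Type*} [NormedAddCommGroup ES] [NormedSpace 𝕜 ES]
  {HS : Type*} [TopologicalSpace HS] {IS : ModelWithCorners 𝕜 ES HS}
  {S : Type*} [TopologicalSpace S] [ChartedSpace HS S]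

lemma contMDiffAt_mfderiv_apply_along [IsManifold IM 1 M] [IsManifold IS 1 S] {f : M → S}
    {b : N → M} (hf : ContMDiffAt IM IS ∞ f (b z)) (hb : ContMDiffAt J IM ∞ b z)
    {v : ∀ y : N, TangentSpace IM (b y)}
    (hv : ContMDiffAt J IM.tangent ∞ (fun y ↦ (⟨b y, v y⟩ : TangentBundle IM M)) z) :
    ContMDiffAt J IS.tangent ∞
      (fun y ↦ (⟨f (b y), mfderiv IM IS f (b y) (v y)⟩ : TangentBundle IS S)) z :=
  ContMDiffAt.clm_apply_of_inCoordinates ((hf.mfderiv_const (m := ∞) (by simp)).comp z hb) hv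
    (hf.comp z hb)

lemma contMDiffAt_tangentBundle_const [IsManifold IM 1 M] (x : M) {A : N → EM}
    (hA : ContMDiffAt J 𝓘(𝕜, EM) ∞ A z) :
    ContMDiffAt J IM.tangent ∞ (fun y ↦ (⟨x, A y⟩ : TangentBundle IM M)) z := by
  refine (Bundle.contMDiffAt_totalSpace (E := (TangentSpace IM : M → Type _))).2
    ⟨contMDiffAt_const, ?_⟩
  let e := trivializationAt EM (TangentSpace IM) x
  have hx : x ∈ e.baseSet := FiberBundle.mem_baseSet_trivializationAt' x
  let L : EM →L[𝕜] EM := e.continuousLinearMapAt 𝕜 x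
  refine (L.contDiff.contMDiff.contMDiffAt.comp z hA).congr_of_eventuallyEq
    (Filter.Eventually.of_forall fun y ↦ ?_)
  exact (congrFun (Bundle.Trivialization.coe_linearMapAt_of_mem e hx) (A y)).symm

variable {EG : Type*} [NormedAddCommGroup EG] [NormedSpace 𝕜 EG]
  {HG : Type*} [TopologicalSpace HG] {IG : ModelWithCorners 𝕜 EG HG}
  {G : Type*} [TopologicalSpace G] [ChartedSpace HG G] [Group G]

lemma contMDiffAt_infinitesimalAction [IsManifold IG ∞ G] [IsManifold IS ∞ S] [MulAction G S]
    [ContMDiffSMul IG IS ∞ G S] {κ : N → S} {A : N → EG}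
    (hκ : ContMDiffAt J IS ∞ κ z) (hA : ContMDiffAt J 𝓘(𝕜, EG) ∞ A z) :
    ContMDiffAt J IS.tangent ∞
      (fun y ↦ (⟨κ y, infinitesimalAction (G := G) IG IS (κ y) (A y)⟩ :
        TangentBundle IS S)) z := by
  have hact : ContMDiff (IG.prod IS) IS ∞ (fun p : G × S ↦ p.1 • p.2) := contMDiff_smul
  have hA_one := contMDiffAt_tangentBundle_const (IM := IG) (1 : G) hA
  have hκ_zero : ContMDiffAt J IS.tangent ∞ (fun y ↦ (⟨κ y, 0⟩ : TangentBundle IS S)) z :=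
    (Bundle.contMDiff_zeroSection 𝕜 (TangentSpace IS : S → Type _)).contMDiffAt.comp z hκ
  have hprod := (contMDiff_equivTangentBundleProd_symm (I := IG) (M := G) (I' := IS) (M' := S)
    (n := ∞)).contMDiffAt.comp z (hA_one.prodMk hκ_zero)
  refine (contMDiffAt_mfderiv_apply_along (hact (1, κ z)) (b := fun y ↦ ((1 : G), κ y))
    (contMDiffAt_const.prodMk hκ) hprod).congr_of_eventuallyEq
    (Filter.Eventually.of_forall fun y ↦ ?_)
  have hpartial : mfderiv (IG.prod IS) IS (fun p : G × S ↦ p.1 • p.2) (1, κ y)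
      ((A y, 0) : EG × ES) = mfderiv IG IS (fun g : G ↦ g • κ y) 1 (A y) := by
    have h := mfderiv_prod_eq_add_apply (v := ((A y, 0) : EG × ES))
      ((hact (1, κ y)).mdifferentiableAt (by simp))
    exact h.trans ((congrArg _ (map_zero _)).trans (add_zero _))
  have hbase : ∀ s : S, s = κ y → ∀ w : ES,
    (⟨κ y, w⟩ : TangentBundle IS S) = (⟨s, w⟩ : TangentBundle IS S) := by rintro _ rfl w; rfl
  refine (hbase ((1 : G) • κ y) (one_smul _ _) _).trans ?_
  exact congrArg (fun w : ES ↦ (⟨(1 : G) • κ y, w⟩ : TangentBundle IS S)) hpartial.symm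

variable {F : Type*} [NormedAddCommGroup F] [NormedSpace 𝕜 F] [FiniteDimensional 𝕜 F]
  {φ : G →* (F ≃L[𝕜] F)}

lemma IsLinearLieGroup.contMDiffAt_of_lieAlgebraRep_apply (hφ : IsLinearLieGroup IG φ)
    {A : N → EG}
    (hA : ∀ ξ, ContMDiffAt J 𝓘(𝕜, F) ∞ (fun y ↦ lieAlgebraRep IG φ (A y) ξ) z) :
    ContMDiffAt J 𝓘(𝕜, EG) ∞ A z := by
  obtain ⟨L, hL⟩ := (lieAlgebraRep IG φ).toLinearMap.exists_leftInverse_of_injective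
    (LinearMap.ker_eq_bot.2 hφ.injective_mfderiv)
  let L' : (F →L[𝕜] F) →L[𝕜] EG := L.toContinuousLinearMap
  refine (L'.contDiff.contMDiff.contMDiffAt.comp z
    (contMDiffAt_clm_of_apply hA)).congr_of_eventuallyEq (Filter.Eventually.of_forall fun y ↦ ?_)
  exact (LinearMap.congr_fun hL (A y)).symm

variable {E : M → Type*} [TopologicalSpace (Bundle.TotalSpace F E)]
  [∀ x, AddCommGroup (E x)] [∀ x, Module 𝕜 (E x)] [∀ x, TopologicalSpace (E x)]
  [∀ x, IsTopologicalAddGroup (E x)] [∀ x, ContinuousSMul 𝕜 (E x)]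
  [FiberBundle F E] [VectorBundle 𝕜 F E] [IsManifold IM 1 M] {ι : Type*}

lemma GStructure.contMDiffAt_connectionForm_along (P : GStructure IM IG E φ ι)
    {cov : CovariantDerivative IM F E} (hcov : IsSmoothConnection IM cov) {i : ι} {b : N → M}
    (hz : b z ∈ P.baseSet i) {v : ∀ y, TangentSpace IM (b y)}
    (hv : ContMDiffAt J IM.tangent ∞ (fun y ↦ (⟨b y, v y⟩ : TangentBundle IM M)) z) (ξ : F) :
    ContMDiffAt J 𝓘(𝕜, F) ∞ (fun y ↦ P.connectionForm cov i (b y) (v y) ξ) z := by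
  have hb : ContMDiffAt J IM ∞ b z :=
    ((Bundle.contMDiffAt_totalSpace (E := (TangentSpace IM : M → Type _))).1 hv).1
  have hcov_frame := (hcov _ (P.isOpen_baseSet i)).contMDiff (P.contMDiffOn_frame i ξ)
  have hcov_along := (hcov_frame.contMDiffAt ((P.isOpen_baseSet i).mem_nhds hz)).comp z hb
  exact P.contMDiffAt_frame_symm_apply hz (ContMDiffAt.clm_bundle_apply hcov_along hv)

end AlongMap

section Distribution

variable {𝕜 : Type*} [RCLike 𝕜]
  {EM : Type*} [NormedAddCommGroup EM] [NormedSpace 𝕜 EM]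
  {HM : Type*} [TopologicalSpace HM] {IM : ModelWithCorners 𝕜 EM HM}
  {M : Type*} [TopologicalSpace M] [ChartedSpace HM M] [IsManifold IM ∞ M]
  {F : Type*} [NormedAddCommGroup F] [NormedSpace 𝕜 F]
  {E : M → Type*} [TopologicalSpace (Bundle.TotalSpace F E)]
  [∀ x, AddCommGroup (E x)] [∀ x, Module 𝕜 (E x)] [∀ x, TopologicalSpace (E x)]
  [FiberBundle F E]
  {EG : Type*} [NormedAddCommGroup EG] [NormedSpace 𝕜 EG]
  {HG : Type*} [TopologicalSpace HG] {IG : ModelWithCorners 𝕜 EG HG}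
  {G : Type*} [TopologicalSpace G] [ChartedSpace HG G] [Group G]
  {φ : G →* (F ≃L[𝕜] F)} {hφ : IsLinearLieGroup IG φ}
  {ι : Type*} {P : GStructure IM IG E φ ι}
  {ES : Type*} [NormedAddCommGroup ES] [NormedSpace 𝕜 ES]
  {HS : Type*} [TopologicalSpace HS] {IS : ModelWithCorners 𝕜 ES HS}
  {S : Type*} [TopologicalSpace S] [ChartedSpace HS S] [IsManifold IS ∞ S]
  [MulAction G S] [ContMDiffSMul IG IS ∞ G S]

namespace OrbitBundle

variable {z : OrbitBundle IS S P hφ} {i : ι} {incl : S → Submodule 𝕜 F}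

lemma mfderiv_proj_trivHomeo_symm {p : M × S} (hp : p.1 ∈ P.baseSet i)
    (hz : (trivHomeo hφ P IS S i).symm p = z) (V : TangentSpace (IM.prod IS) p) :
    mfderiv (IM.prod IS) IM proj z
      (mfderiv (IM.prod IS) (IM.prod IS) (trivHomeo hφ P IS S i).symm p V) = V.1 := by
  subst hz
  have hderiv := mfderiv_fst (I := IM) (I' := IS) (x := p)
  have hchain := mfderiv_comp p (mdifferentiableAt_proj ((trivHomeo hφ P IS S i).symm p))
    ((contMDiffAt_trivHomeo_symm hp).mdifferentiableAt (by simp))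
  exact congrArg (fun L : (EM × ES) →L[𝕜] EM ↦ L V) (hchain.symm.trans hderiv)

lemma mfderiv_coord_trivHomeo_symm {p : M × S} (hp : p.1 ∈ P.baseSet i)
    (hz : (trivHomeo hφ P IS S i).symm p = z) (V : TangentSpace (IM.prod IS) p) :
    mfderiv (IM.prod IS) IS (coord i) z
      (mfderiv (IM.prod IS) (IM.prod IS) (trivHomeo hφ P IS S i).symm p V) = V.2 := by
  subst hz
  have hsnd : coord i ∘ (trivHomeo hφ P IS S i).symm =ᶠ[𝓝 p] Prod.snd := by
    filter_upwards [(trivHomeo hφ P IS S i).open_target.mem_nhds (mem_trivHomeo_target.2 hp)]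
      with p' hp'
    exact congrArg (Prod.snd : M × S → S) ((trivHomeo hφ P IS S i).right_inv hp')
  have hderiv := (hsnd.mfderiv_eq (I := IM.prod IS) (I' := IS)).trans mfderiv_snd
  have hchain := mfderiv_comp p
    (mdifferentiableAt_coord (z := (trivHomeo hφ P IS S i).symm p) hp)
    ((contMDiffAt_trivHomeo_symm hp).mdifferentiableAt (by simp))
  exact congrArg (fun L : (EM × ES) →L[𝕜] ES ↦ L V) (hchain.symm.trans hderiv)

variable (i) in
lemma exists_vectorField_of_components (v : ∀ y : OrbitBundle IS S P hφ, TangentSpace IM y.proj)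
    (w : ∀ y : OrbitBundle IS S P hφ, TangentSpace IS (y.coord i)) :
    ∃ X : ∀ y : OrbitBundle IS S P hφ, TangentSpace (IM.prod IS) y,
      ∀ y : OrbitBundle IS S P hφ, y.proj ∈ P.baseSet i →
        mfderiv (IM.prod IS) IM proj y (X y) = v y ∧
        mfderiv (IM.prod IS) IS (coord i) y (X y) = w y ∧
        (ContMDiffAt (IM.prod IS) IM.tangent ∞
            (fun y ↦ (⟨y.proj, v y⟩ : TangentBundle IM M)) y →
          ContMDiffAt (IM.prod IS) IS.tangent ∞
            (fun y ↦ (⟨y.coord i, w y⟩ : TangentBundle IS S)) y →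
          ContMDiffAt (IM.prod IS) (IM.prod IS).tangent ∞
            (fun y ↦ (⟨y, X y⟩ : TangentBundle (IM.prod IS) (OrbitBundle IS S P hφ))) y) := by
  refine ⟨fun y ↦ mfderiv (IM.prod IS) (IM.prod IS) (trivHomeo hφ P IS S i).symm
    (y.proj, y.coord i) (v y, w y), fun y hy ↦ ?_⟩
  have hinv := (trivHomeo hφ P IS S i).left_inv (mem_trivHomeo_source.2 hy)
  refine ⟨mfderiv_proj_trivHomeo_symm hy hinv _, mfderiv_coord_trivHomeo_symm hy hinv _,
    fun hv hw ↦ ?_⟩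
  have hprod := (contMDiff_equivTangentBundleProd_symm (I := IM) (M := M) (I' := IS) (M' := S)
    (n := ∞)).contMDiffAt.comp y (hv.prodMk hw)
  refine (contMDiffAt_mfderiv_apply_along (b := fun y ↦ (y.proj, y.coord i))
    (contMDiffAt_trivHomeo_symm (hφ := hφ) (p := (y.proj, y.coord i)) hy)
    (contMDiffAt_trivHomeo hy) hprod).congr_of_eventuallyEq ?_
  filter_upwards [eventually_proj_mem hy] with y' hy'
  have hbase : ∀ y'', y'' = y' → ∀ V : EM × ES,
      (⟨y', V⟩ : TangentBundle (IM.prod IS) (OrbitBundle IS S P hφ)) = ⟨y'', V⟩ := by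
    rintro _ rfl V; rfl
  exact hbase _ ((trivHomeo hφ P IS S i).left_inv (mem_trivHomeo_source.2 hy')) _

variable [∀ x, IsTopologicalAddGroup (E x)] [∀ x, ContinuousSMul 𝕜 (E x)]
  {cov : CovariantDerivative IM F E} {ρ : ∀ x, E x →L[𝕜] TangentSpace IM x} {r : EM → F →L[𝕜] EM}

omit [IsManifold IM ∞ M] [IsManifold IS ∞ S] in
lemma mem_distribution_iff
    (hsmul : ∀ (g : G) (s : S), incl (g • s) = (incl s).map ((φ g : F →L[𝕜] F) : F →ₗ[𝕜] F))
    (hz : z.proj ∈ P.baseSet i) {W : TangentSpace (IM.prod IS) z} :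
    W ∈ z.distribution cov ρ incl ↔ W ∈ z.horizontal cov ∧ ∃ f ∈ incl (z.coord i),
      mfderiv (IM.prod IS) IM proj z W = ρ z.proj (P.frame i z.proj f) := by
  rw [distribution, Submodule.mem_inf, subspace_eq hsmul z hz]
  refine and_congr_right fun _ ↦ ⟨?_, ?_⟩
  · rintro ⟨_, ⟨f, hf, rfl⟩, h⟩
    exact ⟨f, hf, h.symm⟩
  · rintro ⟨f, hf, h⟩
    exact ⟨_, ⟨f, hf, rfl⟩, h.symm⟩

lemma eventually_exists_localAnchor_eq
    (hsmul : ∀ (g : G) (s : S), incl (g • s) = (incl s).map ((φ g : F →L[𝕜] F) : F →ₗ[𝕜] F))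
    (hz : z.proj ∈ P.baseSet i) (hr : P.IsLocalAnchor ρ i z.proj r) :
    ∀ᶠ y in 𝓝 z, ∀ W ∈ y.distribution cov ρ incl, ∃ f ∈ incl (y.coord i),
      mvfderiv (IM.prod IS) (baseChart z.proj) y W = r (baseChart z.proj y) f := by
  have hproj := (contMDiffAt_proj z).continuousAt
  filter_upwards [eventually_proj_mem hz, hproj.eventually hr.eventually_eq,
    hproj.eventually ((chartAt HM z.proj).open_source.mem_nhds (mem_chart_source HM z.proj))]
    with y hy hry hchart W hW
  obtain ⟨-, f, hf, hfW⟩ := (mem_distribution_iff hsmul hy).1 hW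
  exact ⟨f, hf, by rw [mvfderiv_baseChart hchart, hfW, hry]; rfl⟩

theorem exists_tautological_lift [FiniteDimensional 𝕜 F] [CompleteSpace EM]
    (hincl : IsGrassmannianSubmanifold IS incl)
    (hsmul : ∀ (g : G) (s : S), incl (g • s) = (incl s).map ((φ g : F →L[𝕜] F) : F →ₗ[𝕜] F))
    (hinj : Set.InjOn (ρ z.proj) (z.subspace incl)) (hz : z.proj ∈ P.baseSet i)
    (hr : P.IsLocalAnchor ρ i z.proj r)
    {X : ∀ y : OrbitBundle IS S P hφ, TangentSpace (IM.prod IS) y}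
    (hX : MDifferentiableAt (IM.prod IS) (IM.prod IS).tangent
      (fun y ↦ (⟨y, X y⟩ : TangentBundle (IM.prod IS) (OrbitBundle IS S P hφ))) z)
    (hX_mem : ∀ᶠ y in 𝓝 z, X y ∈ y.distribution cov ρ incl) :
    ∃ e : OrbitBundle IS S P hφ → F, MDifferentiableAt (IM.prod IS) 𝓘(𝕜, F) e z ∧
      (∀ᶠ y in 𝓝 z, e y ∈ incl (y.coord i)) ∧
      ∀ᶠ y in 𝓝 z, mvfderiv (IM.prod IS) (baseChart z.proj) y (X y)
        = r (baseChart z.proj y) (e y) := by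
  obtain ⟨Φ, hΦ⟩ := hincl.exists_isMovingFrame (z.coord i)
  have hcoord := mdifferentiableAt_coord hz
  have hchart : ContMDiffAt (IM.prod IS) 𝓘(𝕜, EM) 2 (baseChart z.proj) z :=
    (contMDiffAt_baseChart z).of_le ENat.LEInfty.out
  have hΦ_coord : MDifferentiableAt (IM.prod IS) 𝓘(𝕜, F →L[𝕜] F)
      (fun y : OrbitBundle IS S P hφ ↦ Φ (y.coord i)) z :=
    (hΦ.contMDiffAt_self.mdifferentiableAt (by simp)).comp z hcoord
  let Ψ (y : OrbitBundle IS S P hφ) : incl (z.coord i) →L[𝕜] EM :=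
    r (baseChart z.proj y) ∘L (Φ (y.coord i) ∘L (incl (z.coord i)).subtypeL)
  have hΨ : MDifferentiableAt (IM.prod IS) 𝓘(𝕜, incl (z.coord i) →L[𝕜] EM) Ψ z :=
    ((hr.contDiffAt.contMDiffAt.mdifferentiableAt (by simp)).comp z
      (hchart.mdifferentiableAt two_ne_zero)).clm_comp (hΦ_coord.clm_comp mdifferentiableAt_const)
  have hΨz (f : incl (z.coord i)) : Ψ z f = ρ z.proj (P.frame i z.proj f) := by
    rw [← mvfderiv_extChartAt_self (ρ z.proj (P.frame i z.proj f)),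
      hr.eventually_eq.self_of_nhds f]
    simp only [Ψ, ContinuousLinearMap.comp_apply, hΦ.apply_self]
    rfl
  have hΨ_inj : Function.Injective (Ψ z) := fun f f' hff' ↦ by
    rw [hΨz, hΨz] at hff'
    exact Subtype.ext <| (P.frame i z.proj).injective <| hinj
      ((frame_mem_subspace_iff hsmul hz).2 f.2) ((frame_mem_subspace_iff hsmul hz).2 f'.2) hff'
  obtain ⟨b, hb, hΨb⟩ := exists_mdifferentiableAt_preimage hΨ hΨ_inj
    (mdifferentiableAt_mvfderiv_apply hchart hX) <| by
      filter_upwards [hX_mem, eventually_exists_localAnchor_eq hsmul hz hr,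
        hcoord.continuousAt.eventually hΦ.eq_map] with y hXy hlift hmap
      obtain ⟨f, hf, hfX⟩ := hlift (X y) hXy
      rw [hmap] at hf
      obtain ⟨c, hc, rfl⟩ := hf
      exact ⟨⟨c, hc⟩, hfX.symm⟩
  refine ⟨fun y ↦ Φ (y.coord i) (b y), hΦ_coord.clm_apply
    ((mdifferentiableAt_const (c := (incl (z.coord i)).subtypeL)).clm_apply hb), ?_,
    hΨb.mono fun y hy ↦ hy.symm⟩
  filter_upwards [hcoord.continuousAt.eventually hΦ.eq_map] with y hmap
  rw [hmap]
  exact ⟨b y, (b y).2, rfl⟩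

variable [FiniteDimensional 𝕜 F] [VectorBundle 𝕜 F E]

theorem exists_horizontal_lift [IsManifold IG ∞ G] [ContMDiffVectorBundle 1 F E IM]
    (hincl : IsGrassmannianSubmanifold IS incl)
    (hsmul : ∀ (g : G) (s : S), incl (g • s) = (incl s).map ((φ g : F →L[𝕜] F) : F →ₗ[𝕜] F))
    (hcov : IsSmoothConnection IM cov) (hcomp : P.IsCompatible cov) (i : ι)
    (v : ∀ y : OrbitBundle IS S P hφ, TangentSpace IM y.proj) :
    ∃ X : ∀ y : OrbitBundle IS S P hφ, TangentSpace (IM.prod IS) y,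
      ∀ y : OrbitBundle IS S P hφ, y.proj ∈ P.baseSet i →
        X y ∈ y.horizontal cov ∧ mfderiv (IM.prod IS) IM proj y (X y) = v y ∧
        (ContMDiffAt (IM.prod IS) IM.tangent ∞
            (fun y ↦ (⟨y.proj, v y⟩ : TangentBundle IM M)) y →
          ContMDiffAt (IM.prod IS) (IM.prod IS).tangent ∞
            (fun y ↦ (⟨y, X y⟩ : TangentBundle (IM.prod IS) (OrbitBundle IS S P hφ))) y) := by
  choose! A hA using
    show ∀ y : OrbitBundle IS S P hφ, y.proj ∈ P.baseSet i →
        ∃ A : EG, ∀ ξ, lieAlgebraRep IG φ A ξ = P.connectionForm cov i y.proj (v y) ξ from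
      fun y hy ↦ hcomp i y.proj hy (v y)
  obtain ⟨X, hX⟩ := exists_vectorField_of_components i v fun y ↦
    infinitesimalAction (G := G) IG IS (y.coord i) (-A y)
  refine ⟨X, fun y hy ↦ ?_⟩
  obtain ⟨hXv, hXA, hXs⟩ := hX y hy
  refine ⟨mem_horizontal_of_isHorizontalIn hincl hsmul hcomp hy
    ⟨A y, by rw [hXv]; exact hA y hy, hXA.trans (map_neg _ _)⟩, hXv, fun hv ↦ hXs hv ?_⟩
  have hAs : ContMDiffAt (IM.prod IS) 𝓘(𝕜, EG) ∞ A y :=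
    hφ.contMDiffAt_of_lieAlgebraRep_apply fun ξ ↦
      (P.contMDiffAt_connectionForm_along hcov (b := proj) hy hv ξ).congr_of_eventuallyEq <| by
        filter_upwards [eventually_proj_mem hy] with y' hy' using hA y' hy' ξ
  exact contMDiffAt_infinitesimalAction (contMDiffAt_coord hy) hAs.neg

theorem exists_section_distribution [IsManifold IG ∞ G] [ContMDiffVectorBundle 1 F E IM]
    (hincl : IsGrassmannianSubmanifold IS incl)
    (hsmul : ∀ (g : G) (s : S), incl (g • s) = (incl s).map ((φ g : F →L[𝕜] F) : F →ₗ[𝕜] F))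
    (hcov : IsSmoothConnection IM cov) (hcomp : P.IsCompatible cov) (hρ : IsSmoothAnchor IM F ρ)
    {e : E z.proj} (he : e ∈ z.subspace incl) :
    ∃ X : ∀ y : OrbitBundle IS S P hφ, TangentSpace (IM.prod IS) y,
      mfderiv (IM.prod IS) IM proj z (X z) = ρ z.proj e ∧ ∀ᶠ y in 𝓝 z,
        X y ∈ y.distribution cov ρ incl ∧
        ContMDiffAt (IM.prod IS) (IM.prod IS).tangent ∞
          (fun y ↦ (⟨y, X y⟩ : TangentBundle (IM.prod IS) (OrbitBundle IS S P hφ))) y := by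
  have hz := P.mem_baseSet_at z.proj
  set i := P.indexAt z.proj
  obtain ⟨f, hf, rfl⟩ := he
  obtain ⟨g, hgz, hg⟩ := exists_tautological_extension hincl hz hf
  obtain ⟨X, hX⟩ := exists_horizontal_lift hincl hsmul hcov hcomp i fun y ↦
    ρ y.proj (P.frame i y.proj (g y))
  refine ⟨X, by rw [(hX z hz).2.1, hgz]; rfl, ?_⟩
  filter_upwards [hg, eventually_proj_mem hz] with y ⟨hgy, hgy_mem⟩ hy
  obtain ⟨hXy, hXv, hXs⟩ := hX y hy
  exact ⟨(mem_distribution_iff hsmul hy).2 ⟨hXy, g y, hgy_mem, hXv⟩, hXs <|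
    ContMDiffAt.clm_bundle_apply ((hρ y.proj).comp y (contMDiffAt_proj y))
      (P.contMDiffAt_frame_apply hy (contMDiffAt_proj y) hgy)⟩

end OrbitBundle

end Distribution

theorem IsIntegrableDistribution.mlieBracket_mem {𝕜 : Type*} [RCLike 𝕜]
    {EN : Type*} [NormedAddCommGroup EN] [NormedSpace 𝕜 EN]
    {HN : Type*} [TopologicalSpace HN] {J : ModelWithCorners 𝕜 EN HN}
    {N : Type*} [TopologicalSpace N] [ChartedSpace HN N] [IsManifold J 1 N]
    {D : ∀ z : N, Submodule 𝕜 (TangentSpace J z)} (hD : IsIntegrableDistribution J D)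
    {X Y : ∀ z : N, TangentSpace J z} {z : N}
    (hX : ∀ᶠ y in 𝓝 z, X y ∈ D y ∧
      ContMDiffAt J J.tangent ∞ (fun y ↦ (⟨y, X y⟩ : TangentBundle J N)) y)
    (hY : ∀ᶠ y in 𝓝 z, Y y ∈ D y ∧
      ContMDiffAt J J.tangent ∞ (fun y ↦ (⟨y, Y y⟩ : TangentBundle J N)) y) :
    VectorField.mlieBracket J X Y z ∈ D z := by
  obtain ⟨U, hU, hU_open, hz⟩ := eventually_nhds_iff.1 (hX.and hY)
  exact hD U hU_open X Y (fun y hy ↦ (hU y hy).1.2.contMDiffWithinAt)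
    (fun y hy ↦ (hU y hy).2.2.contMDiffWithinAt) (fun y hy ↦ (hU y hy).1.1)
    (fun y hy ↦ (hU y hy).2.1) z hz

section Integrability

variable {𝕜 : Type*} [RCLike 𝕜]
  {EM : Type*} [NormedAddCommGroup EM] [NormedSpace 𝕜 EM]
  {HM : Type*} [TopologicalSpace HM] {IM : ModelWithCorners 𝕜 EM HM}
  {M : Type*} [TopologicalSpace M] [ChartedSpace HM M] [IsManifold IM ∞ M]
  {F : Type*} [NormedAddCommGroup F] [NormedSpace 𝕜 F] [FiniteDimensional 𝕜 F]
  {E : M → Type*} [TopologicalSpace (Bundle.TotalSpace F E)]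
  [∀ x, AddCommGroup (E x)] [∀ x, Module 𝕜 (E x)] [∀ x, TopologicalSpace (E x)]
  [∀ x, IsTopologicalAddGroup (E x)] [∀ x, ContinuousSMul 𝕜 (E x)]
  [FiberBundle F E]
  {EG : Type*} [NormedAddCommGroup EG] [NormedSpace 𝕜 EG]
  {HG : Type*} [TopologicalSpace HG] {IG : ModelWithCorners 𝕜 EG HG}
  {G : Type*} [TopologicalSpace G] [ChartedSpace HG G] [Group G]
  {φ : G →* (F ≃L[𝕜] F)} {hφ : IsLinearLieGroup IG φ}
  {ι : Type*} {P : GStructure IM IG E φ ι}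
  {ES : Type*} [NormedAddCommGroup ES] [NormedSpace 𝕜 ES]
  {HS : Type*} [TopologicalSpace HS] {IS : ModelWithCorners 𝕜 ES HS}
  {S : Type*} [TopologicalSpace S] [ChartedSpace HS S] [IsManifold IS ∞ S]
  [MulAction G S] [ContMDiffSMul IG IS ∞ G S]
  {incl : S → Submodule 𝕜 F} {cov : CovariantDerivative IM F E}
  {ρ : ∀ x, E x →L[𝕜] TangentSpace IM x}

namespace OrbitBundle

variable {z : OrbitBundle IS S P hφ} {i : ι}
  {X Y : ∀ y : OrbitBundle IS S P hφ, TangentSpace (IM.prod IS) y}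

lemma covDerivAlong_covDerivAlong_mem {Γ : EM → EM →L[𝕜] F →L[𝕜] F}
    (hincl : IsGrassmannianSubmanifold IS incl)
    (hsmul : ∀ (g : G) (s : S), incl (g • s) = (incl s).map ((φ g : F →L[𝕜] F) : F →ₗ[𝕜] F))
    (hi : z.proj ∈ P.baseSet i) (hΓ : P.IsLocalConnectionForm cov i z.proj Γ)
    (hY : MDifferentiableAt (IM.prod IS) (IM.prod IS).tangent
      (fun y ↦ (⟨y, Y y⟩ : TangentBundle (IM.prod IS) (OrbitBundle IS S P hφ))) z)
    (hX_mem : X z ∈ z.horizontal cov) (hY_mem : ∀ᶠ y in 𝓝 z, Y y ∈ y.horizontal cov)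
    {g : OrbitBundle IS S P hφ → F} (hg : ContMDiffAt (IM.prod IS) 𝓘(𝕜, F) 2 g z)
    (hg_mem : ∀ᶠ y in 𝓝 z, g y ∈ incl (y.coord i)) :
    covDerivAlong (IM.prod IS) (baseChart z.proj) Γ
      (fun y ↦ covDerivAlong (IM.prod IS) (baseChart z.proj) Γ g y (Y y)) z (X z)
      ∈ incl (z.coord i) := by
  have hpull := eventually_pullbackCov_eq_covDerivAlong (z := z) hΓ
  rw [← hpull.self_of_nhds]
  refine IsHorizontalIn.pullbackCov_mem hincl hsmul hi (hX_mem i hi)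
    (mdifferentiableAt_covDerivAlong ((contMDiffAt_baseChart z).of_le ENat.LEInfty.out)
      (hΓ.contDiffAt.differentiableAt (by simp)) hg hY) ?_
  filter_upwards [hpull, hY_mem, eventually_proj_mem hi, hg_mem.eventually_nhds,
    (contMDiffAt_iff_contMDiffAt_nhds (by simp)).1 hg] with y hy hYy hyi hgy_mem hgy
  rw [← hy]
  exact IsHorizontalIn.pullbackCov_mem hincl hsmul hyi (hYy i hyi)
    (hgy.mdifferentiableAt two_ne_zero) hgy_mem

variable [CompleteSpace EM] [CompleteSpace ES] [IM.Boundaryless] [IS.Boundaryless]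
  [VectorBundle 𝕜 F E] [ContMDiffVectorBundle ∞ F E IM]

theorem pullbackCov_mlieBracket_add_curvature_mem (hincl : IsGrassmannianSubmanifold IS incl)
    (hsmul : ∀ (g : G) (s : S), incl (g • s) = (incl s).map ((φ g : F →L[𝕜] F) : F →ₗ[𝕜] F))
    (hcov : IsSmoothConnection IM cov) (hi : z.proj ∈ P.baseSet i)
    (hX : MDifferentiableAt (IM.prod IS) (IM.prod IS).tangent
      (fun y ↦ (⟨y, X y⟩ : TangentBundle (IM.prod IS) (OrbitBundle IS S P hφ))) z)
    (hY : MDifferentiableAt (IM.prod IS) (IM.prod IS).tangent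
      (fun y ↦ (⟨y, Y y⟩ : TangentBundle (IM.prod IS) (OrbitBundle IS S P hφ))) z)
    (hX_mem : ∀ᶠ y in 𝓝 z, X y ∈ y.horizontal cov)
    (hY_mem : ∀ᶠ y in 𝓝 z, Y y ∈ y.horizontal cov)
    {g : OrbitBundle IS S P hφ → F} (hg : ContMDiffAt (IM.prod IS) 𝓘(𝕜, F) 2 g z)
    (hg_mem : ∀ᶠ y in 𝓝 z, g y ∈ incl (y.coord i)) :
    pullbackCov cov i g z (VectorField.mlieBracket (IM.prod IS) X Y z)
        + (P.frame i z.proj).symm (connectionCurvature IM cov z.proj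
          (mfderiv (IM.prod IS) IM proj z (X z)) (mfderiv (IM.prod IS) IM proj z (Y z))
          (P.frame i z.proj (g z)))
      ∈ incl (z.coord i) := by
  have : IsManifold (IM.prod IS) 2 (OrbitBundle IS S P hφ) := .of_le (n := ∞) ENat.LEInfty.out
  obtain ⟨Γ, hΓ⟩ := P.exists_isLocalConnectionForm hcov hi
  have hcomm := covDerivAlong_commutator ((contMDiffAt_baseChart z).of_le ENat.LEInfty.out)
    (hΓ.contDiffAt.differentiableAt (by simp)) hg hX hY
  rw [mvfderiv_baseChart_self, mvfderiv_baseChart_self] at hcomm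
  rw [hΓ.connectionCurvature_eq hi, ContinuousLinearEquiv.symm_apply_apply,
    ContinuousLinearEquiv.symm_apply_apply,
    (eventually_pullbackCov_eq_covDerivAlong hΓ).self_of_nhds]
  convert sub_mem
    (covDerivAlong_covDerivAlong_mem hincl hsmul hi hΓ hY hX_mem.self_of_nhds hY_mem hg hg_mem)
    (covDerivAlong_covDerivAlong_mem hincl hsmul hi hΓ hX hY_mem.self_of_nhds hX_mem hg hg_mem)
    using 1
  exact add_comm _ _ |>.trans (sub_eq_iff_eq_add.1 hcomm).symm

theorem mlieBracket_mem_horizontal_iff (hincl : IsGrassmannianSubmanifold IS incl)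
    (hsmul : ∀ (g : G) (s : S), incl (g • s) = (incl s).map ((φ g : F →L[𝕜] F) : F →ₗ[𝕜] F))
    (hcov : IsSmoothConnection IM cov) (hcomp : P.IsCompatible cov)
    (hX : MDifferentiableAt (IM.prod IS) (IM.prod IS).tangent
      (fun y ↦ (⟨y, X y⟩ : TangentBundle (IM.prod IS) (OrbitBundle IS S P hφ))) z)
    (hY : MDifferentiableAt (IM.prod IS) (IM.prod IS).tangent
      (fun y ↦ (⟨y, Y y⟩ : TangentBundle (IM.prod IS) (OrbitBundle IS S P hφ))) z)
    (hX_mem : ∀ᶠ y in 𝓝 z, X y ∈ y.horizontal cov)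
    (hY_mem : ∀ᶠ y in 𝓝 z, Y y ∈ y.horizontal cov) :
    VectorField.mlieBracket (IM.prod IS) X Y z ∈ z.horizontal cov ↔
      ∀ e ∈ z.subspace incl, connectionCurvature IM cov z.proj
        (mfderiv (IM.prod IS) IM proj z (X z)) (mfderiv (IM.prod IS) IM proj z (Y z)) e
          ∈ z.subspace incl := by
  have : ContMDiffVectorBundle 1 F E IM := .of_le (n := ∞) ENat.LEInfty.out
  have hi := P.mem_baseSet_at z.proj
  set i := P.indexAt z.proj
  have hbracket {g : OrbitBundle IS S P hφ → F} (hg : ContMDiffAt (IM.prod IS) 𝓘(𝕜, F) ∞ g z) :=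
    pullbackCov_mlieBracket_add_curvature_mem hincl hsmul hcov hi hX hY hX_mem hY_mem
      (hg.of_le ENat.LEInfty.out)
  constructor
  · rintro hXY _ ⟨f, hf, rfl⟩
    obtain ⟨g, rfl, hg⟩ := exists_tautological_extension hincl hi hf
    have hg_smooth := hg.self_of_nhds.1
    have hg_mem := hg.mono fun _ h ↦ h.2
    have hpull := IsHorizontalIn.pullbackCov_mem hincl hsmul hi (hXY i hi)
      (hg_smooth.mdifferentiableAt (by simp)) hg_mem
    have hcurv := (add_mem_cancel_left hpull).1 (hbracket hg_smooth hg_mem)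
    rwa [← frame_mem_subspace_iff hsmul hi, ContinuousLinearEquiv.apply_symm_apply] at hcurv
  · intro hR
    refine mem_horizontal_of_forall_pullbackCov_mem hincl hsmul hcomp hi fun g hg hg_mem ↦ ?_
    refine (add_mem_cancel_right ?_).1 (hbracket hg hg_mem)
    rw [← frame_mem_subspace_iff hsmul hi, ContinuousLinearEquiv.apply_symm_apply]
    exact hR _ ((frame_mem_subspace_iff hsmul hi).2 hg_mem.self_of_nhds)

theorem mfderiv_proj_mlieBracket_add_torsion_mem (hincl : IsGrassmannianSubmanifold IS incl)
    (hsmul : ∀ (g : G) (s : S), incl (g • s) = (incl s).map ((φ g : F →L[𝕜] F) : F →ₗ[𝕜] F))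
    (hcov : IsSmoothConnection IM cov) (hρ : IsSmoothAnchor IM F ρ)
    (hinj : Set.InjOn (ρ z.proj) (z.subspace incl))
    (hX : MDifferentiableAt (IM.prod IS) (IM.prod IS).tangent
      (fun y ↦ (⟨y, X y⟩ : TangentBundle (IM.prod IS) (OrbitBundle IS S P hφ))) z)
    (hY : MDifferentiableAt (IM.prod IS) (IM.prod IS).tangent
      (fun y ↦ (⟨y, Y y⟩ : TangentBundle (IM.prod IS) (OrbitBundle IS S P hφ))) z)
    (hX_mem : ∀ᶠ y in 𝓝 z, X y ∈ y.distribution cov ρ incl)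
    (hY_mem : ∀ᶠ y in 𝓝 z, Y y ∈ y.distribution cov ρ incl)
    {e₁ e₂ : E z.proj} (he₁ : e₁ ∈ z.subspace incl) (he₂ : e₂ ∈ z.subspace incl)
    (hXe₁ : mfderiv (IM.prod IS) IM proj z (X z) = ρ z.proj e₁)
    (hYe₂ : mfderiv (IM.prod IS) IM proj z (Y z) = ρ z.proj e₂) :
    mfderiv (IM.prod IS) IM proj z (VectorField.mlieBracket (IM.prod IS) X Y z)
        + anchoredTorsion IM cov ρ z.proj e₁ e₂
      ∈ (z.subspace incl).map (ρ z.proj : E z.proj →ₗ[𝕜] TangentSpace IM z.proj) := by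
  have : IsManifold (IM.prod IS) 2 (OrbitBundle IS S P hφ) := .of_le (n := ∞) ENat.LEInfty.out
  have hi := P.mem_baseSet_at z.proj
  set i := P.indexAt z.proj
  obtain ⟨Γ, hΓ⟩ := P.exists_isLocalConnectionForm hcov hi
  obtain ⟨r, hr⟩ := P.exists_isLocalAnchor hρ hi
  have hrz (ξ : F) : r (baseChart z.proj z) ξ = ρ z.proj (P.frame i z.proj ξ) :=
    (hr.eventually_eq.self_of_nhds ξ).symm.trans (mvfderiv_extChartAt_self _)
  obtain ⟨f₁, hf₁, hf₁_mem, hXf₁⟩ := exists_tautological_lift hincl hsmul hinj hi hr hX hX_mem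
  obtain ⟨f₂, hf₂, hf₂_mem, hYf₂⟩ := exists_tautological_lift hincl hsmul hinj hi hr hY hY_mem
  have lift_eq {W : TangentSpace (IM.prod IS) z} {e : E z.proj} {ξ : F}
      (he : e ∈ z.subspace incl) (hξ : ξ ∈ incl (z.coord i))
      (hWe : mfderiv (IM.prod IS) IM proj z W = ρ z.proj e)
      (hWξ : mvfderiv (IM.prod IS) (baseChart z.proj) z W = r (baseChart z.proj z) ξ) :
      (P.frame i z.proj).symm e = ξ := by
    rw [ContinuousLinearEquiv.symm_apply_eq]
    refine hinj he ((frame_mem_subspace_iff hsmul hi).2 hξ) ?_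
    rw [← hWe, ← mvfderiv_baseChart_self, hWξ, hrz]
  have hbracket := mvfderiv_mlieBracket_eq_sub_localTorsion (Γ := Γ)
    ((contMDiffAt_baseChart z).of_le ENat.LEInfty.out)
    (hr.contDiffAt.differentiableAt (by simp)) hf₁ hf₂ hX hY hXf₁ hYf₂
  have htorsion := hΓ.anchoredTorsion_eq hr hρ hi e₁ e₂
  rw [lift_eq he₁ hf₁_mem.self_of_nhds hXe₁ hXf₁.self_of_nhds,
    lift_eq he₂ hf₂_mem.self_of_nhds hYe₂ hYf₂.self_of_nhds] at htorsion
  rw [mvfderiv_baseChart_self, hrz] at hbracket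
  have hpull := (eventually_pullbackCov_eq_covDerivAlong (z := z) hΓ).self_of_nhds
  refine ⟨_, (frame_mem_subspace_iff hsmul hi).2 (sub_mem ?_ ?_),
    (eq_sub_iff_add_eq.1 (htorsion ▸ hbracket)).symm⟩
  · rw [← hpull]
    exact IsHorizontalIn.pullbackCov_mem hincl hsmul hi (hX_mem.self_of_nhds.1 i hi) hf₂ hf₂_mem
  · rw [← hpull]
    exact IsHorizontalIn.pullbackCov_mem hincl hsmul hi (hY_mem.self_of_nhds.1 i hi) hf₁ hf₁_mem

theorem mlieBracket_mem_distribution_iff (hincl : IsGrassmannianSubmanifold IS incl)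
    (hsmul : ∀ (g : G) (s : S), incl (g • s) = (incl s).map ((φ g : F →L[𝕜] F) : F →ₗ[𝕜] F))
    (hcov : IsSmoothConnection IM cov) (hcomp : P.IsCompatible cov) (hρ : IsSmoothAnchor IM F ρ)
    (hinj : Set.InjOn (ρ z.proj) (z.subspace incl))
    (hX : MDifferentiableAt (IM.prod IS) (IM.prod IS).tangent
      (fun y ↦ (⟨y, X y⟩ : TangentBundle (IM.prod IS) (OrbitBundle IS S P hφ))) z)
    (hY : MDifferentiableAt (IM.prod IS) (IM.prod IS).tangent
      (fun y ↦ (⟨y, Y y⟩ : TangentBundle (IM.prod IS) (OrbitBundle IS S P hφ))) z)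
    (hX_mem : ∀ᶠ y in 𝓝 z, X y ∈ y.distribution cov ρ incl)
    (hY_mem : ∀ᶠ y in 𝓝 z, Y y ∈ y.distribution cov ρ incl)
    {e₁ e₂ : E z.proj} (he₁ : e₁ ∈ z.subspace incl) (he₂ : e₂ ∈ z.subspace incl)
    (hXe₁ : mfderiv (IM.prod IS) IM proj z (X z) = ρ z.proj e₁)
    (hYe₂ : mfderiv (IM.prod IS) IM proj z (Y z) = ρ z.proj e₂) :
    VectorField.mlieBracket (IM.prod IS) X Y z ∈ z.distribution cov ρ incl ↔
      (∀ e₃ ∈ z.subspace incl,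
        connectionCurvature IM cov z.proj (ρ z.proj e₁) (ρ z.proj e₂) e₃ ∈ z.subspace incl) ∧
      ∃ e ∈ z.subspace incl, anchoredTorsion IM cov ρ z.proj e₁ e₂ = ρ z.proj e := by
  have hhor := mlieBracket_mem_horizontal_iff hincl hsmul hcov hcomp hX hY
    (hX_mem.mono fun _ h ↦ h.1) (hY_mem.mono fun _ h ↦ h.1)
  have hadd := mfderiv_proj_mlieBracket_add_torsion_mem hincl hsmul hcov hρ hinj hX hY hX_mem
    hY_mem he₁ he₂ hXe₁ hYe₂
  rw [hXe₁, hYe₂] at hhor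
  have hproj : mfderiv (IM.prod IS) IM proj z (VectorField.mlieBracket (IM.prod IS) X Y z)
        ∈ (z.subspace incl).map (ρ z.proj : E z.proj →ₗ[𝕜] TangentSpace IM z.proj) ↔
      anchoredTorsion IM cov ρ z.proj e₁ e₂
        ∈ (z.subspace incl).map (ρ z.proj : E z.proj →ₗ[𝕜] TangentSpace IM z.proj) :=
    ⟨fun h ↦ (add_mem_cancel_left h).1 hadd, fun h ↦ (add_mem_cancel_right h).1 hadd⟩
  simp only [eq_comm (a := anchoredTorsion IM cov ρ z.proj e₁ e₂)]
  exact and_congr hhor hproj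

theorem isIntegrableDistribution_distribution_iff [IsManifold IG ∞ G]
    (hincl : IsGrassmannianSubmanifold IS incl)
    (hsmul : ∀ (g : G) (s : S), incl (g • s) = (incl s).map ((φ g : F →L[𝕜] F) : F →ₗ[𝕜] F))
    (hcov : IsSmoothConnection IM cov) (hcomp : P.IsCompatible cov) (hρ : IsSmoothAnchor IM F ρ)
    (hinj : ∀ z : OrbitBundle IS S P hφ, Set.InjOn (ρ z.proj) (z.subspace incl)) :
    IsIntegrableDistribution (IM.prod IS)
        (fun z : OrbitBundle IS S P hφ ↦ z.distribution cov ρ incl) ↔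
      ∀ z : OrbitBundle IS S P hφ, ∀ e₁ ∈ z.subspace incl, ∀ e₂ ∈ z.subspace incl,
        (∀ e₃ ∈ z.subspace incl,
          connectionCurvature IM cov z.proj (ρ z.proj e₁) (ρ z.proj e₂) e₃ ∈ z.subspace incl) ∧
        ∃ e ∈ z.subspace incl, anchoredTorsion IM cov ρ z.proj e₁ e₂ = ρ z.proj e := by
  have : ContMDiffVectorBundle 1 F E IM := .of_le (n := ∞) ENat.LEInfty.out
  constructor
  · intro hint z e₁ he₁ e₂ he₂
    obtain ⟨X, hXe₁, hX⟩ := exists_section_distribution hincl hsmul hcov hcomp hρ he₁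
    obtain ⟨Y, hYe₂, hY⟩ := exists_section_distribution hincl hsmul hcov hcomp hρ he₂
    exact (mlieBracket_mem_distribution_iff hincl hsmul hcov hcomp hρ (hinj z)
      (hX.self_of_nhds.2.mdifferentiableAt (by simp))
      (hY.self_of_nhds.2.mdifferentiableAt (by simp)) (hX.mono fun _ h ↦ h.1)
      (hY.mono fun _ h ↦ h.1) he₁ he₂ hXe₁ hYe₂).1 (hint.mlieBracket_mem hX hY)
  · intro hRT U hU X Y hX hY hX_mem hY_mem z hz
    have hUz := hU.mem_nhds hz
    obtain ⟨-, e₁, he₁, hXe₁⟩ := hX_mem z hz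
    obtain ⟨-, e₂, he₂, hYe₂⟩ := hY_mem z hz
    exact (mlieBracket_mem_distribution_iff hincl hsmul hcov hcomp hρ (hinj z)
      ((hX.contMDiffAt hUz).mdifferentiableAt (by simp))
      ((hY.contMDiffAt hUz).mdifferentiableAt (by simp)) (Filter.eventually_of_mem hUz hX_mem)
      (Filter.eventually_of_mem hUz hY_mem) he₁ he₂ hXe₁.symm hYe₂.symm).2 (hRT z e₁ he₁ e₂ he₂)

end OrbitBundle

variable [CompleteSpace EM] [CompleteSpace ES] [IM.Boundaryless] [IS.Boundaryless]
  [VectorBundle 𝕜 F E] [ContMDiffVectorBundle ∞ F E IM] [IsManifold IG ∞ G]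

theorem proposition1p4_general (hincl : IsGrassmannianSubmanifold IS incl)
    (hsmul : ∀ (g : G) (s : S), incl (g • s) = (incl s).map ((φ g : F →L[𝕜] F) : F →ₗ[𝕜] F))
    (hcov : IsSmoothConnection IM cov) (hcomp : P.IsCompatible cov) (hρ : IsSmoothAnchor IM F ρ)
    (hinj : ∀ z : OrbitBundle IS S P hφ, Set.InjOn (ρ z.proj) (z.subspace incl)) :
    (IsIntegrableDistribution (IM.prod IS)
        (fun z : OrbitBundle IS S P hφ ↦ z.distribution cov ρ incl) ↔
      ∀ z : OrbitBundle IS S P hφ,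
        (∀ e₁ ∈ z.subspace incl, ∀ e₂ ∈ z.subspace incl, ∀ e₃ ∈ z.subspace incl,
          connectionCurvature IM cov z.proj (ρ z.proj e₁) (ρ z.proj e₂) e₃ ∈ z.subspace incl) ∧
        (∀ e₁ ∈ z.subspace incl, ∀ e₂ ∈ z.subspace incl,
          ∃ e ∈ z.subspace incl, anchoredTorsion IM cov ρ z.proj e₁ e₂ = ρ z.proj e)) ∧
    ((∀ (x : M) (e₁ e₂ : E x), anchoredTorsion IM cov ρ x e₁ e₂ = 0) →
      IsIntegrableDistribution (IM.prod IS)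
        (fun z : OrbitBundle IS S P hφ ↦ z.distribution cov ρ incl) →
      ∀ z : OrbitBundle IS S P hφ,
        ∀ e₁ ∈ z.subspace incl, ∀ e₂ ∈ z.subspace incl, ∀ e₃ ∈ z.subspace incl,
          connectionCurvature IM cov z.proj (ρ z.proj e₁) (ρ z.proj e₂) e₃
            + connectionCurvature IM cov z.proj (ρ z.proj e₂) (ρ z.proj e₃) e₁
            + connectionCurvature IM cov z.proj (ρ z.proj e₃) (ρ z.proj e₁) e₂ = 0) := by
  have hiff := OrbitBundle.isIntegrableDistribution_distribution_iff hincl hsmul hcov hcomp hρ hinj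
  refine ⟨hiff.trans (forall_congr' fun z ↦ by simp only [forall_and]),
    fun hT hint z e₁ he₁ e₂ he₂ e₃ he₃ ↦ ?_⟩
  have hR {e e' e'' : E z.proj} (he : e ∈ z.subspace incl) (he' : e' ∈ z.subspace incl)
      (he'' : e'' ∈ z.subspace incl) := (hiff.1 hint z e he e' he').1 e'' he''
  -- Bianchi's identity only says that `ρ` kills the sum, but the sum stays in `p`.
  refine hinj z (add_mem (add_mem (hR he₁ he₂ he₃) (hR he₂ he₃ he₁)) (hR he₃ he₁ he₂))
    (zero_mem _) ?_
  rw [map_zero]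
  exact P.anchor_cyclic_curvature_eq_zero hcov hρ hT z.proj e₁ e₂ e₃

end Integrability

end

theorem proposition1p4
    {𝕜 : Type*} [RCLike 𝕜]
    -- the base manifold `M`
    {EM : Type*} [NormedAddCommGroup EM] [NormedSpace 𝕜 EM] [FiniteDimensional 𝕜 EM]
    {HM : Type*} [TopologicalSpace HM] {IM : ModelWithCorners 𝕜 EM HM} [IM.Boundaryless]
    {M : Type*} [TopologicalSpace M] [ChartedSpace HM M] [IsManifold IM ∞ M]
    -- the vector bundle `E`, with typical fibre `F`
    {F : Type*} [NormedAddCommGroup F] [NormedSpace 𝕜 F] [FiniteDimensional 𝕜 F]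
    {E : M → Type*} [TopologicalSpace (Bundle.TotalSpace F E)]
    [∀ x, AddCommGroup (E x)] [∀ x, Module 𝕜 (E x)] [∀ x, TopologicalSpace (E x)]
    [∀ x, IsTopologicalAddGroup (E x)] [∀ x, ContinuousSMul 𝕜 (E x)]
    [FiberBundle F E] [VectorBundle 𝕜 F E] [ContMDiffVectorBundle ∞ F E IM]
    -- the structural group `G`, a Lie subgroup of the general linear group of `F`
    {EG : Type*} [NormedAddCommGroup EG] [NormedSpace 𝕜 EG] [FiniteDimensional 𝕜 EG]
    {HG : Type*} [TopologicalSpace HG] {IG : ModelWithCorners 𝕜 EG HG} [IG.Boundaryless]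
    {G : Type*} [TopologicalSpace G] [ChartedSpace HG G] [Group G] [LieGroup IG ∞ G]
    {φ : G →* (F ≃L[𝕜] F)} (hφ : IsLinearLieGroup IG φ)
    {ι : Type*} (P : GStructure IM IG E φ ι)
    -- the submanifold `S` of a Grassmannian of `F`, on which `G` acts transitively
    {ES : Type*} [NormedAddCommGroup ES] [NormedSpace 𝕜 ES] [FiniteDimensional 𝕜 ES]
    {HS : Type*} [TopologicalSpace HS] {IS : ModelWithCorners 𝕜 ES HS} [IS.Boundaryless]
    {S : Type*} [TopologicalSpace S] [ChartedSpace HS S] [IsManifold IS ∞ S]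
    [MulAction G S] [ContMDiffSMul IG IS ∞ G S] [MulAction.IsPretransitive G S]
    (incl : S → Submodule 𝕜 F) (hincl : IsGrassmannianSubmanifold IS incl)
    (hsmul : ∀ (g : G) (s : S),
      incl (g • s) = (incl s).map ((φ g : F →L[𝕜] F) : F →ₗ[𝕜] F))
    -- the connection `∇` on `E`, compatible with `G`
    (cov : CovariantDerivative IM F E) (hcov : IsSmoothConnection IM cov)
    (hcomp : P.IsCompatible cov)
    -- the morphism of vector bundles `ρ : E → TM`, injective on each `p ∈ Z`
    (ρ : ∀ x, E x →L[𝕜] TangentSpace IM x)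
    (hρ : ContMDiff IM (IM.prod 𝓘(𝕜, F →L[𝕜] EM)) ∞
      (fun x ↦ Bundle.TotalSpace.mk' (F →L[𝕜] EM)
        (E := fun x ↦ E x →L[𝕜] TangentSpace IM x) x (ρ x)))
    (hinj : ∀ z : OrbitBundle IS S P hφ, Set.InjOn (ρ z.proj) (z.subspace incl)) :
    (IsIntegrableDistribution (IM.prod IS)
        (fun z : OrbitBundle IS S P hφ ↦ z.distribution cov ρ incl) ↔
      ∀ z : OrbitBundle IS S P hφ,
        (∀ e₁ ∈ z.subspace incl, ∀ e₂ ∈ z.subspace incl, ∀ e₃ ∈ z.subspace incl,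
          connectionCurvature IM cov z.proj (ρ z.proj e₁) (ρ z.proj e₂) e₃ ∈ z.subspace incl) ∧
        (∀ e₁ ∈ z.subspace incl, ∀ e₂ ∈ z.subspace incl,
          ∃ e ∈ z.subspace incl, anchoredTorsion IM cov ρ z.proj e₁ e₂ = ρ z.proj e)) ∧
    ((∀ (x : M) (e₁ e₂ : E x), anchoredTorsion IM cov ρ x e₁ e₂ = 0) →
      IsIntegrableDistribution (IM.prod IS)
        (fun z : OrbitBundle IS S P hφ ↦ z.distribution cov ρ incl) →
      ∀ z : OrbitBundle IS S P hφ,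
        ∀ e₁ ∈ z.subspace incl, ∀ e₂ ∈ z.subspace incl, ∀ e₃ ∈ z.subspace incl,
          connectionCurvature IM cov z.proj (ρ z.proj e₁) (ρ z.proj e₂) e₃
            + connectionCurvature IM cov z.proj (ρ z.proj e₂) (ρ z.proj e₃) e₁
            + connectionCurvature IM cov z.proj (ρ z.proj e₃) (ρ z.proj e₁) e₂ = 0) := by
  have : CompleteSpace EM := FiniteDimensional.complete 𝕜 EM
  have : CompleteSpace ES := FiniteDimensional.complete 𝕜 ES
  exact proposition1p4_general hincl hsmul hcov hcomp hρ hinj
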